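/- **Setting.** On $\mathbb{C}^3$ let $\omega'=\frac i2\sum_j dz_j\wedge d\bar z_j$, $\Omega'=dz_1\wedge dz_2\wedge dz_3$, let $J'$ be the standard complex structure, and let $B_\rho,\overline B_\rho$ be the open and closed balls of radius $\rho$ about $0$. Put $$L_0=\{z:|z_1|^2=|z_2|^2=|z_3|^2,\ \operatorname{Im}(z_1z_2z_3)=0,\ \operatorname{Re}(z_1z_2z_3)\ge 0\},$$ and for $a\in\{1,2,3\}$, $s>0$, $$L^a_s=\{z:|z_a|^2-s=|z_b|^2\ (b\ne a),\ \operatorname{Im}(z_1z_2z_3)=0,\ \operatorname{Re}(z_1z_2z_3)\ge 0\}.$$ An *almost Calabi–Yau 3-fold* $(M,J,\omega,\Omega)$ is a compact connected complex 3-fold $(M,J)$ with the Kähler form $\omega$ of a Kähler metric and a non-vanishing holomorphic $(3,0)$-form $\Omega$. A *special Lagrangian (SL) 3-fold with phase $e^{i\theta}$* in it is a connected embedded real 3-dimensional submanifold $N$ with $\omega|_N=0$ and $(\sin\theta\operatorname{Re}\Omega-\cos\theta\operatorname{Im}\Omega)|_N=0$, oriented so that $\cos\theta\operatorname{Re}\Omega+\sin\theta\operatorname{Im}\Omega$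 is positive on $N$. Let $\epsilon>0$ and let $(M,J_t,\omega_t,\Omega_t)$, $t\in(-\epsilon,\epsilon)$, be a smooth family of almost Calabi–Yau structures on a fixed 6-manifold $M$. Let $N_0\subset M$ be compact with $H_1(N_0,\mathbb{R})=0$, let $x\in N_0$, and let $N_0\setminus\{x\}$ be an SL 3-fold with phase $e^{i\theta}$ in $(M,J_0,\omega_0,\Omega_0)$. Let $\Phi_0:\overline B_\rho\to M$ ($\rho>0$) be a $C^1$ embedding, smooth away from $0$, with $\Phi_0(0)=x$, $\Phi_0^{-1}(N_0)=L_0\cap\overline B_\rho$, $\Phi_0^*\omega_0=\omega'$, and, at the point $0$, $\Phi_0^*J_0=J'$ and $\Phi_0^*\Omega_0=Fe^{i\theta}\Omega'$ for some $F>0$. Let $P=N_0\setminus\Phi_0(B_\rho)$ and $G=\mathrm{U}(1)^2$, and define $$\iota:G\to P,\qquad \iota(e^{i\theta_1},e^{i\theta_2})=\Phi_0\bigl(\tfrac{\rho}{\sqrt3}(e^{i\theta_1},e^{i\theta_2},e^{-i\theta_1-i\theta_2})\bigr).$$ Let $\zeta$ generate $\operatorname{Ker}(\iota_*:H_1(G,\mathbb{Z})\to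 H_1(P,\mathbb{Z}))$. Identify $H_1(G,\mathbb{Z})\cong\mathbb{Z}^2$ so that the circles $e^{i\theta}\mapsto(e^{i\theta},1)$ and $e^{i\theta}\mapsto(1,e^{i\theta})$ represent $(1,0)$ and $(0,1)$. Define $k^1,k^2,k^3\in\mathbb{Z}$ by $\zeta=(k^1,k^2)$ and $k^3=-k^1-k^2$. Let $0<\delta\le\epsilon$ be such that $t/(k^a\pi)<\rho^2$ whenever $a\in\{1,2,3\}$, $|t|<\delta$ and $k^at>0$. For all such $a,t$ let $N^a_t$ be a compact SL 3-fold in $(M,J_t,\omega_t,\Omega_t)$ with phase $e^{i\theta_t}$, and let $\Phi^a_t:\overline B_\rho\to M$ be a smooth embedding, depending smoothly on $t$ and converging uniformly to $\Phi_0$ as $t\to0$, such that: * (a) $(\Phi^a_t)^{-1}(N^a_t)=L^a_{t/(k^a\pi)}\cap\overline B_\rho$; * (b) $(\Phi^a_t)^*\omega_t=\omega'$; * (c) as $t\to0$, at the point $0\in\overline B_\rho$, $(\Phi^a_t)^*J_t\to J'$ and $(\Phi^a_t)^*\Omega_t-F^a_te^{i\theta_t}\Omega'\to0$ for some $F^a_t>0$.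 Suppose also that $N^a_t$ depends smoothly on $t$ and converges to $N_0$ away from $x$, in the sense that there are diffeomorphisms $\Psi^a_t:P\to N^a_t\setminus\Phi^a_t(B_\rho)$ that depend smoothly on $t$ and converge uniformly to the inclusion $P\hookrightarrow M$ as $t\to0$. For a space $N$ let $w(N)=|H_1(N,\mathbb{Z})|$ if $H_1(N,\mathbb{Z})$ is finite, and $w(N)=0$ if it is infinite. **Proposition.** For all $t\in(0,\delta)$ and $t'\in(-\delta,0)$, $$\sum_{a\in\{1,2,3\}:\,k^a>0}w(N^a_t)=\sum_{a\in\{1,2,3\}:\,k^a<0}w(N^a_{t'}).$$ -/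

import Mathlib

open scoped Manifold ContDiff Topology
open Set Metric CategoryTheory

noncomputable section

namespace SLCount

/-! ### Singular homology in degree one -/

/-- The first singular homology module `H₁(X; R)`. -/
abbrev H1 (R : Type) [CommRing R] (X : Type) [TopologicalSpace X] : ModuleCat R :=
  ((AlgebraicTopology.singularHomologyFunctor (ModuleCat R) 1).obj (ModuleCat.of R R)).obj
    (TopCat.of X)

/-- The map `f_* : H₁(X; R) → H₁(Y; R)` induced by a continuous map `f`. -/
def H1map (R : Type) [CommRing R] {X Y : Type} [TopologicalSpace X] [TopologicalSpace Y]
    (f : C(X, Y)) : H1 R X →ₗ[R] H1 R Y :=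
  (((AlgebraicTopology.singularHomologyFunctor (ModuleCat R) 1).obj (ModuleCat.of R R)).map
    (TopCat.ofHom f)).hom

/-- The weight `w(N)`: the order of `H₁(N; ℤ)` if this group is finite, and `0` if it is infinite
(`Nat.card` of an infinite type is `0`). -/
def weight (N : Type) [TopologicalSpace N] : ℤ := Nat.card (H1 ℤ N)

/-! ### The flat structure on `ℂ³` and the local models -/

/-- `ℂ³` with its Hermitian norm.  It is also used as the real model space of 6-manifolds. -/
abbrev C3 : Type := EuclideanSpace ℂ (Fin 3)

/-- The flat Kähler form `ω' = (i/2) ∑ dz_j ∧ dz̄_j = ∑ dx_j ∧ dy_j`. -/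
def flatOmega (v w : C3) : ℝ := ∑ j, (starRingEnd ℂ (v j) * w j).im

/-- The flat holomorphic volume form `Ω' = dz₁ ∧ dz₂ ∧ dz₃`. -/
def flatVol (v : Fin 3 → C3) : ℂ := Matrix.det (Matrix.of fun i j => v i j)

/-- The special Lagrangian `T²`-cone `L₀`. -/
def coneL0 : Set C3 :=
  {z | ‖z 0‖ ^ 2 = ‖z 1‖ ^ 2 ∧ ‖z 1‖ ^ 2 = ‖z 2‖ ^ 2 ∧
    (z 0 * z 1 * z 2).im = 0 ∧ 0 ≤ (z 0 * z 1 * z 2).re}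

/-- The asymptotically conical 3-folds `L^a_s`, where `a = 0, 1, 2` stands for the superscripts
`1, 2, 3`: `|z_a|² - s` equals both other `|z_b|²`, and `z₁z₂z₃` is a nonnegative real. -/
def modelL (a : Fin 3) (s : ℝ) : Set C3 :=
  {z | (∀ b, b ≠ a → ‖z a‖ ^ 2 - s = ‖z b‖ ^ 2) ∧
    (z 0 * z 1 * z 2).im = 0 ∧ 0 ≤ (z 0 * z 1 * z 2).re}

/-- The group `G = U(1)²`. -/
abbrev Torus : Type := Circle × Circle

/-- The point `(ρ/√3) (e^{iθ₁}, e^{iθ₂}, e^{-iθ₁-iθ₂})` of the link of `L₀` in the sphere of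
radius `ρ`. -/
def linkPoint (ρ : ℝ) (g : Torus) : C3 :=
  !₂[((ρ / √3 : ℝ) : ℂ) * (g.1 : ℂ), ((ρ / √3 : ℝ) : ℂ) * (g.2 : ℂ),
    ((ρ / √3 : ℝ) : ℂ) * ((g.1⁻¹ * g.2⁻¹ : Circle) : ℂ)]

theorem continuous_linkPoint (ρ : ℝ) : Continuous (linkPoint ρ) := by
  unfold linkPoint
  have hc : Continuous fun z : Circle => (z : ℂ) := by fun_prop
  refine (PiLp.continuous_toLp 2 _).comp (continuous_pi fun i => ?_)
  fin_cases i
  · exact continuous_const.mul (hc.comp continuous_fst)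
  · exact continuous_const.mul (hc.comp continuous_snd)
  · exact continuous_const.mul (hc.comp (continuous_fst.inv.mul continuous_snd.inv))

theorem norm_linkPoint_apply (ρ : ℝ) (g : Torus) (j : Fin 3) :
    ‖linkPoint ρ g j‖ = |ρ / √3| := by
  fin_cases j
  · exact (norm_mul _ _).trans (by rw [Circle.norm_coe, mul_one, Complex.norm_real]; rfl)
  · exact (norm_mul _ _).trans (by rw [Circle.norm_coe, mul_one, Complex.norm_real]; rfl)
  · exact (norm_mul _ _).trans (by rw [Circle.norm_coe, mul_one, Complex.norm_real]; rfl)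

theorem norm_linkPoint {ρ : ℝ} (hρ : 0 < ρ) (g : Torus) : ‖linkPoint ρ g‖ = ρ := by
  have h : ‖linkPoint ρ g‖ ^ 2 = ρ ^ 2 := by
    rw [EuclideanSpace.norm_sq_eq, Fin.sum_univ_three]
    simp only [norm_linkPoint_apply, sq_abs, div_pow]
    rw [Real.sq_sqrt (by norm_num)]
    ring
  exact (sq_eq_sq₀ (norm_nonneg _) hρ.le).1 h

theorem linkPoint_mem {ρ : ℝ} (hρ : 0 < ρ) (g : Torus) : linkPoint ρ g ∈ coneL0 := by
  have h : linkPoint ρ g 0 * linkPoint ρ g 1 * linkPoint ρ g 2 = (((ρ / √3) ^ 3 : ℝ) : ℂ) := by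
    have h1 : (g.1 : ℂ) ≠ 0 := Circle.coe_ne_zero _
    have h2 : (g.2 : ℂ) ≠ 0 := Circle.coe_ne_zero _
    have h3 : ((√3 : ℝ) : ℂ) ≠ 0 := by
      exact_mod_cast (Real.sqrt_pos.2 (by norm_num : (0 : ℝ) < 3)).ne'
    simp [linkPoint]
    field_simp
  refine ⟨by simp only [norm_linkPoint_apply], by simp only [norm_linkPoint_apply], ?_, ?_⟩
  · rw [h]; exact Complex.ofReal_im _
  · rw [h, Complex.ofReal_re]; positivity

/-! ### Tensors on a real 6-manifold, and almost Calabi--Yau 3-folds -/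

section Geometry

variable {M : Type} [TopologicalSpace M] [ChartedSpace C3 M]

/-- The tangent space at `x` of the real 6-manifold `M`. -/
abbrev T (M : Type) [TopologicalSpace M] [ChartedSpace C3 M] (x : M) : Type :=
  TangentSpace 𝓘(ℝ, C3) x

/-- The derivative of a local coordinate system `φ` at a point of `M`. -/
def dChart (φ : OpenPartialHomeomorph M C3) (x : M) : T M x →L[ℝ] C3 :=
  mfderiv 𝓘(ℝ, C3) 𝓘(ℝ, C3) φ x

/-- The derivative of the local parametrization `φ⁻¹` at a point of `ℂ³`. -/
def dChartSymm (φ : OpenPartialHomeomorph M C3) (y : C3) : C3 →L[ℝ] T M (φ.symm y) :=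
  mfderiv 𝓘(ℝ, C3) 𝓘(ℝ, C3) φ.symm y

/-- The expression of a differential `k`-form in local coordinates, i.e. its pullback by `φ⁻¹`. -/
def formInChart {k : ℕ} {F : Type} [NormedAddCommGroup F] [NormedSpace ℝ F]
    (α : ∀ x : M, T M x [⋀^Fin k]→L[ℝ] F) (φ : OpenPartialHomeomorph M C3) (y : C3) :
    C3 [⋀^Fin k]→L[ℝ] F :=
  (α (φ.symm y)).compContinuousLinearMap (dChartSymm φ y)

/-- The expression of a field of endomorphisms of the tangent spaces in local coordinates. -/
def endInChart (J : ∀ x : M, T M x →L[ℝ] T M x) (φ : OpenPartialHomeomorph M C3) (y : C3) :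
    C3 →L[ℝ] C3 :=
  (dChart φ (φ.symm y)) ∘L (J (φ.symm y)) ∘L (dChartSymm φ y)

/-- `φ` is a smooth local coordinate system that is holomorphic for the almost complex
structure `J`. -/
def IsHolomorphicChart (J : ∀ x : M, T M x →L[ℝ] T M x) (φ : OpenPartialHomeomorph M C3) : Prop :=
  φ ∈ IsManifold.maximalAtlas 𝓘(ℝ, C3) ∞ M ∧
    ∀ x ∈ φ.source, ∀ v : T M x, dChart φ x (J x v) = Complex.I • dChart φ x v

variable (M) in
/-- An almost Calabi--Yau structure `(J, ω, Ω)` on a (compact, connected) smooth real 6-manifold: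
`J` is a complex structure, `ω` the Kähler form of a Kähler metric on `(M, J)`, and `Ω` a
non-vanishing holomorphic `(3,0)`-form. -/
structure AlmostCY where
  /-- the complex structure -/
  J : ∀ x : M, T M x →L[ℝ] T M x
  /-- the Kähler form -/
  kah : ∀ x : M, T M x [⋀^Fin 2]→L[ℝ] ℝ
  /-- the holomorphic volume form -/
  vol : ∀ x : M, T M x [⋀^Fin 3]→L[ℝ] ℂ
  J_smooth : ∀ φ ∈ atlas C3 M, ContDiffOn ℝ ∞ (endInChart J φ) φ.target
  J_sq : ∀ x v, J x (J x v) = -v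
  J_integrable : ∀ x, ∃ φ, IsHolomorphicChart J φ ∧ x ∈ φ.source
  kah_smooth : ∀ φ ∈ atlas C3 M, ContDiffOn ℝ ∞ (formInChart kah φ) φ.target
  kah_closed : ∀ φ ∈ atlas C3 M, ∀ y ∈ φ.target, extDeriv (formInChart kah φ) y = 0
  kah_J : ∀ x v w, kah x ![J x v, J x w] = kah x ![v, w]
  kah_pos : ∀ x v, v ≠ 0 → 0 < kah x ![v, J x v]
  vol_type : ∀ x u v w, vol x ![J x u, v, w] = Complex.I * vol x ![u, v, w]
  vol_ne_zero : ∀ x, vol x ≠ 0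
  vol_holomorphic : ∀ φ, IsHolomorphicChart J φ →
    DifferentiableOn ℂ
      (fun y => formInChart vol φ y fun i => EuclideanSpace.single i (1 : ℂ)) φ.target

/-- The structures `(J_t, ω_t, Ω_t)`, `t ∈ (-ε, ε)`, depend smoothly on `t`. -/
structure IsSmoothFamily (A : ℝ → AlmostCY M) (ε : ℝ) : Prop where
  J_smooth : ∀ φ ∈ atlas C3 M, ContDiffOn ℝ ∞
    (fun p : ℝ × C3 => endInChart (A p.1).J φ p.2) (Ioo (-ε) ε ×ˢ φ.target)
  kah_smooth : ∀ φ ∈ atlas C3 M, ContDiffOn ℝ ∞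
    (fun p : ℝ × C3 => formInChart (A p.1).kah φ p.2) (Ioo (-ε) ε ×ˢ φ.target)
  vol_smooth : ∀ φ ∈ atlas C3 M, ContDiffOn ℝ ∞
    (fun p : ℝ × C3 => formInChart (A p.1).vol φ p.2) (Ioo (-ε) ε ×ˢ φ.target)

/-! ### Special Lagrangian 3-folds -/

/-- `φ` is a smooth coordinate system of `M` in which `N` is the slice `ℝ³ ⊂ ℂ³`. -/
def IsSliceChart (N : Set M) (φ : OpenPartialHomeomorph M C3) : Prop :=
  φ ∈ IsManifold.maximalAtlas 𝓘(ℝ, C3) ∞ M ∧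
    ∀ y ∈ φ.source, y ∈ N ↔ ∀ j, (φ y j).im = 0

/-- The tangent vectors of an embedded 3-dimensional submanifold `N` at `y ∈ N`. -/
def tangentVectors (N : Set M) (y : M) : Set (T M y) :=
  {v | ∃ φ, IsSliceChart N φ ∧ y ∈ φ.source ∧ ∀ j, (dChart φ y v j).im = 0}

/-- `N` is a connected embedded (not necessarily closed) special Lagrangian 3-fold with phase
`e^{iθ}`.  The form `cos θ Re Ω + sin θ Im Ω` vanishes nowhere on `N`; the orientation of `N` is
the one for which it is positive. -/
structure IsSL (A : AlmostCY M) (N : Set M) (θ : ℝ) : Prop where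
  connected : IsConnected N
  submanifold : ∀ y ∈ N, ∃ φ, IsSliceChart N φ ∧ y ∈ φ.source
  lagrangian : ∀ y ∈ N, ∀ v ∈ tangentVectors N y, ∀ w ∈ tangentVectors N y, A.kah y ![v, w] = 0
  phase : ∀ y ∈ N, ∀ v : Fin 3 → T M y, (∀ i, v i ∈ tangentVectors N y) →
    Real.sin θ * (A.vol y v).re - Real.cos θ * (A.vol y v).im = 0
  oriented : ∀ y ∈ N, ∀ v : Fin 3 → T M y, (∀ i, v i ∈ tangentVectors N y) →
    LinearIndependent ℝ v → Real.cos θ * (A.vol y v).re + Real.sin θ * (A.vol y v).im ≠ 0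

/-! ### Special Lagrangian 3-folds with a `T²`-cone singularity -/

/-- The derivative at `z` of a map defined on the closed ball of radius `ρ` in `ℂ³`. -/
def dBall (ρ : ℝ) (f : C3 → M) (z : C3) : C3 →L[ℝ] T M (f z) :=
  mfderivWithin 𝓘(ℝ, C3) 𝓘(ℝ, C3) f (closedBall 0 ρ) z

/-- A compact embedded singular special Lagrangian 3-fold `N₀` with phase `e^{iθ}` in an almost
Calabi--Yau 3-fold, with one singular point `x`, at which it is modelled on the cone `L₀` through
an embedding `Φ` of the closed ball of radius `ρ`, and with `H₁(N₀; ℝ) = 0`.  The requirement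
that `Φ^*J ≈ J'` and `Φ^*Ω ≈ F e^{iθ} Ω'` near `0` means equality at `0` (these tensors are
continuous). -/
structure ConeSingularity (A : AlmostCY M) where
  N₀ : Set M
  x : M
  θ : ℝ
  ρ : ℝ
  Φ : C3 → M
  compact : IsCompact N₀
  mem : x ∈ N₀
  special : IsSL A (N₀ \ {x}) θ
  ρ_pos : 0 < ρ
  Φ_C1 : ContMDiffOn 𝓘(ℝ, C3) 𝓘(ℝ, C3) 1 Φ (closedBall 0 ρ)
  Φ_smooth : ContMDiffOn 𝓘(ℝ, C3) 𝓘(ℝ, C3) ∞ Φ (closedBall 0 ρ \ {0})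
  Φ_injOn : InjOn Φ (closedBall 0 ρ)
  Φ_immersion : ∀ z ∈ closedBall (0 : C3) ρ, Function.Injective (dBall ρ Φ z)
  Φ_zero : Φ 0 = x
  Φ_model : ∀ z ∈ closedBall (0 : C3) ρ, Φ z ∈ N₀ ↔ z ∈ coneL0
  Φ_kah : ∀ z ∈ closedBall (0 : C3) ρ, ∀ v w : C3,
    A.kah (Φ z) ![dBall ρ Φ z v, dBall ρ Φ z w] = flatOmega v w
  Φ_J : ∀ v : C3, A.J (Φ 0) (dBall ρ Φ 0 v) = dBall ρ Φ 0 (Complex.I • v)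
  Φ_vol : ∃ F : ℝ, 0 < F ∧ ∀ v : Fin 3 → C3,
    A.vol (Φ 0) (fun i => dBall ρ Φ 0 (v i)) = F * Complex.exp (θ * Complex.I) * flatVol v
  homology : Subsingleton (H1 ℝ N₀)

namespace ConeSingularity

variable {A : AlmostCY M} (S : ConeSingularity A)

/-- The compact 3-manifold with boundary `P = N₀ \ Φ(B_ρ)`. -/
def P : Set M := S.N₀ \ S.Φ '' ball 0 S.ρ

theorem linkPoint_mem_closedBall (g : Torus) : linkPoint S.ρ g ∈ closedBall (0 : C3) S.ρ := by
  rw [mem_closedBall_zero_iff, norm_linkPoint S.ρ_pos]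

theorem Φ_linkPoint_mem (g : Torus) : S.Φ (linkPoint S.ρ g) ∈ S.P := by
  refine ⟨(S.Φ_model _ (S.linkPoint_mem_closedBall g)).2 (linkPoint_mem S.ρ_pos g), ?_⟩
  rintro ⟨z, hz, hzg⟩
  have h := S.Φ_injOn (ball_subset_closedBall hz) (S.linkPoint_mem_closedBall g) hzg
  rw [h, mem_ball_zero_iff, norm_linkPoint S.ρ_pos] at hz
  exact lt_irrefl _ hz

/-- The map `ι : G → P`,
`(e^{iθ₁}, e^{iθ₂}) ↦ Φ((ρ/√3) (e^{iθ₁}, e^{iθ₂}, e^{-iθ₁-iθ₂}))`, onto the boundary of `P`. -/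
def ι : C(Torus, S.P) where
  toFun g := ⟨S.Φ (linkPoint S.ρ g), S.Φ_linkPoint_mem g⟩
  continuous_toFun := Continuous.subtype_mk
    (S.Φ_C1.continuousOn.comp_continuous (continuous_linkPoint S.ρ) S.linkPoint_mem_closedBall) _

/-- `ζ ∈ H₁(G; ℤ)` generates the kernel of `ι_* : H₁(G; ℤ) → H₁(P; ℤ)`. -/
def IsKernelGenerator (ζ : H1 ℤ Torus) : Prop :=
  Submodule.span ℤ {ζ} = LinearMap.ker (H1map ℤ S.ι)

end ConeSingularity

/-- `(k¹, k², k³)` (indexed by `0, 1, 2`) are the integers determined by `ζ ∈ H₁(G; ℤ)`: under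
the identification `H₁(G; ℤ) ≅ ℤ²` in which the circles `e^{iθ} ↦ (e^{iθ}, 1)` and
`e^{iθ} ↦ (1, e^{iθ})` represent `(1, 0)` and `(0, 1)`, the class `ζ` is `(k¹, k²)`, and
`k³ = -k¹ - k²`.  Here `u` is the generator of `H₁(S¹; ℤ) ≅ ℤ` that serves as fundamental class
of the circle (the other choice has the same effect as changing the sign of `ζ`). -/
def IsIndexTriple (u : H1 ℤ Circle) (ζ : H1 ℤ Torus) (k : Fin 3 → ℤ) : Prop :=
  ζ = k 0 • H1map ℤ ⟨fun z => ((z, 1) : Torus), by fun_prop⟩ u +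
      k 1 • H1map ℤ ⟨fun z => ((1, z) : Torus), by fun_prop⟩ u ∧
    k 2 = -k 0 - k 1

/-! ### The desingularizations `N^a_t` -/

/-- The parameters `t` for which `N^a_t` exists: `|t| < δ` and `k^a t > 0`. -/
def params (k : Fin 3 → ℤ) (δ : ℝ) (a : Fin 3) : Set ℝ := {t | |t| < δ ∧ 0 < (k a : ℝ) * t}

/-- The families of compact nonsingular embedded special Lagrangian 3-folds `N^a_t` in
`(M, J_t, ω_t, Ω_t)`, for `a = 1, 2, 3` (indexed by `0, 1, 2`), `|t| < δ` and `k^a t > 0`, which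
depend smoothly on `t`, converge to `N₀` as `t → 0`, and near the singular point are modelled
on `L^a_s` with `s = t / (k^a π)`. -/
structure Desingularization (A : ℝ → AlmostCY M) (ε : ℝ) (S : ConeSingularity (A 0))
    (k : Fin 3 → ℤ) where
  δ : ℝ
  N : Fin 3 → ℝ → Set M
  θ : ℝ → ℝ
  δ_pos : 0 < δ
  δ_le : δ ≤ ε
  /-- `δ` is so small that the models `L^a_s` used meet the interior of the ball of radius `ρ`. -/
  δ_small : ∀ a, ∀ t ∈ params k δ a, t / (k a * Real.pi) < S.ρ ^ 2
  compact : ∀ a, ∀ t ∈ params k δ a, IsCompact (N a t)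
  special : ∀ a, ∀ t ∈ params k δ a, IsSL (A t) (N a t) (θ t)
  /-- The embeddings `Φ^a_t` of the closed ball of radius `ρ`, extended to `t = 0` by `Φ₀`. -/
  Φ : Fin 3 → ℝ → C3 → M
  Φ_smooth : ∀ a, ContMDiffOn (𝓘(ℝ, ℝ).prod 𝓘(ℝ, C3)) 𝓘(ℝ, C3) ∞
    (fun p : ℝ × C3 => Φ a p.1 p.2) (params k δ a ×ˢ closedBall 0 S.ρ)
  Φ_injOn : ∀ a, ∀ t ∈ params k δ a, InjOn (Φ a t) (closedBall 0 S.ρ)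
  Φ_immersion : ∀ a, ∀ t ∈ params k δ a, ∀ z ∈ closedBall (0 : C3) S.ρ,
    Function.Injective (dBall S.ρ (Φ a t) z)
  Φ_zero : ∀ a, EqOn (Φ a 0) S.Φ (closedBall 0 S.ρ)
  /-- `Φ^a_t → Φ₀` uniformly as `t → 0`. -/
  Φ_cont : ∀ a, ContinuousOn (fun p : ℝ × C3 => Φ a p.1 p.2)
    (insert 0 (params k δ a) ×ˢ closedBall 0 S.ρ)
  Φ_model : ∀ a, ∀ t ∈ params k δ a, ∀ z ∈ closedBall (0 : C3) S.ρ,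
    Φ a t z ∈ N a t ↔ z ∈ modelL a (t / (k a * Real.pi))
  Φ_kah : ∀ a, ∀ t ∈ params k δ a, ∀ z ∈ closedBall (0 : C3) S.ρ, ∀ v w : C3,
    (A t).kah (Φ a t z) ![dBall S.ρ (Φ a t) z v, dBall S.ρ (Φ a t) z w] = flatOmega v w
  /-- `(Φ^a_t)^*(J_t) ≈ J'` for small `t`, near `0`. -/
  Φ_J : ∀ a, ∀ v : C3, Filter.Tendsto
    (fun t => (dBall S.ρ (Φ a t) 0).inverse ((A t).J (Φ a t 0) (dBall S.ρ (Φ a t) 0 v)))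
    (𝓝[params k δ a] 0) (𝓝 (Complex.I • v))
  /-- `(Φ^a_t)^*(Ω_t) ≈ F_t e^{iθ_t} Ω'` for small `t`, near `0`. -/
  Φ_vol : ∀ a, ∃ F : ℝ → ℝ, (∀ t ∈ params k δ a, 0 < F t) ∧ ∀ v : Fin 3 → C3, Filter.Tendsto
    (fun t => (A t).vol (Φ a t 0) (fun i => dBall S.ρ (Φ a t) 0 (v i)) -
      F t * Complex.exp (θ t * Complex.I) * flatVol v)
    (𝓝[params k δ a] 0) (𝓝 0)
  /-- Diffeomorphisms from `P` onto `P^a_t = N^a_t \ Φ^a_t(B_ρ)`, depending smoothly on `t`, which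
  are extended to `t = 0` by the identity of `P`: away from the singular point, `N^a_t` depends
  smoothly on `t` and converges to `N₀`. -/
  Ψ : Fin 3 → ℝ → M → M
  Ψ_smooth : ∀ a, ContMDiffOn (𝓘(ℝ, ℝ).prod 𝓘(ℝ, C3)) 𝓘(ℝ, C3) ∞
    (fun p : ℝ × M => Ψ a p.1 p.2) (params k δ a ×ˢ S.P)
  Ψ_bijOn : ∀ a, ∀ t ∈ params k δ a, BijOn (Ψ a t) S.P (N a t \ Φ a t '' ball 0 S.ρ)
  Ψ_inv_smooth : ∀ a, ∀ t ∈ params k δ a, ∃ g : M → M, LeftInvOn g (Ψ a t) S.P ∧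
    ContMDiffOn 𝓘(ℝ, C3) 𝓘(ℝ, C3) ∞ g (N a t \ Φ a t '' ball 0 S.ρ)
  Ψ_zero : ∀ a, EqOn (Ψ a 0) id S.P
  /-- `Ψ^a_t` tends to the identity of `P` uniformly as `t → 0`. -/
  Ψ_cont : ∀ a, ContinuousOn (fun p : ℝ × M => Ψ a p.1 p.2) (insert 0 (params k δ a) ×ˢ S.P)

end Geometry

end SLCount

end

/-!
The 3-fold `N^a_t` is the union of `P^a_t ≅ P` and of the solid torus `Φ^a_t(L^a_s ∩ B̄_ρ)`, where
`s = t / (k^a π) > 0`: in `L^a_s` the coordinate `z_a` never vanishes, and its argument together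
with `z_{a+1}` identifies `L^a_s ∩ B̄_ρ` with `S¹ × D²` (`solidTorus`).  So `N^a_t` is a Dehn filling
of `P` (`Desingularization.isDehnFilling`), and `H₁(N^a_t; ℤ)` is the quotient of `H₁(P; ℤ)` by the
class of the meridian (`IsDehnFilling.surjective_and_ker`).  Letting `t → 0` deforms the boundary of
the solid torus in `N^a_t` to the boundary of `P` (`Desingularization.exists_homotopic_boundary`),
which shows that the meridian is the image under `ι_*` of `(0, 1)`, `(-1, 0)`, `(1, -1)` for
`a = 1, 2, 3`.

In the quotient of `ℤ²` by such a class, which is a copy of `ℤ`, the generator `ζ = (k¹, k²)` of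
`Ker ι_*` becomes `± k^a`.  Hence `|H₁(N^a_t; ℤ)| = |k^a| · [H₁(P; ℤ) : ι_* H₁(G; ℤ)]` whenever
`k^a ≠ 0`, with `0` standing for infinity (`Desingularization.weight_eq`), and the assertion reduces
to `k¹ + k² + k³ = 0`.

What is used of singular homology is built from the first cohomology: homomorphisms out of
`H₁(X; ℤ)` correspond to functions on the singular 1-simplices of `X` that are additive along
2-simplices (`Cocycle`), modulo coboundaries.  Such cocycles on the two members of an open cover can
be glued when they agree on the intersection (`exists_glue`), which replaces barycentric subdivision
and yields the part of the Mayer–Vietoris sequence that is needed (`exists_extension_of_cover`,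
`eq_zero_of_cover`).  The homology of the torus comes from the fact that addition of maps into a
topological group induces addition in homology (`H1map_mul`).
-/

open scoped Manifold ContDiff Topology
open Set Metric CategoryTheory

noncomputable section

namespace SLCount

/-! ### Singular 1-cocycles and the first homology group -/

/-- The standard topological `n`-simplex. -/
abbrev Simplex (n : ℕ) : Type := stdSimplex ℝ (Fin (n + 1))

/-- The inclusion of the face of the standard simplex opposite to the vertex `i`. -/
def face {n : ℕ} (i : Fin (n + 2)) : C(Simplex n, Simplex (n + 1)) :=
  ⟨stdSimplex.map i.succAbove, stdSimplex.continuous_map _⟩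

/-- The `i`-th vertex of the standard simplex. -/
abbrev vtx {n : ℕ} (i : Fin (n + 1)) : Simplex n := stdSimplex.vertex i

theorem face_vtx {n : ℕ} (i : Fin (n + 2)) (j : Fin (n + 1)) :
    face i (vtx j) = vtx (i.succAbove j) :=
  stdSimplex.map_vertex _ _

section Cocycle

open scoped Simplicial

variable {X Y Z : Type} [TopologicalSpace X] [TopologicalSpace Y] [TopologicalSpace Z]
variable {A : Type} [AddCommGroup A]

/-- A singular 1-cocycle on `X` with values in `A`: a function on singular 1-simplices whose
alternating sum over the faces of every singular 2-simplex vanishes. -/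
structure Cocycle (X : Type) [TopologicalSpace X] (A : Type) [AddCommGroup A] where
  /-- the value on a singular 1-simplex -/
  toFun : C(Simplex 1, X) → A
  map_face : ∀ σ : C(Simplex 2, X),
    toFun (σ.comp (face 1)) = toFun (σ.comp (face 0)) + toFun (σ.comp (face 2))

namespace Cocycle

instance : CoeFun (Cocycle X A) fun _ => C(Simplex 1, X) → A := ⟨toFun⟩

@[ext]
theorem ext {c c' : Cocycle X A} (h : ∀ γ, c γ = c' γ) : c = c' := by
  cases c; cases c'; congr 1; exact funext h

/-- The pullback of a cocycle by a continuous map. -/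
def comap (c : Cocycle Y A) (f : C(X, Y)) : Cocycle X A where
  toFun γ := c (f.comp γ)
  map_face σ := c.map_face (f.comp σ)

@[simp]
theorem comap_apply (c : Cocycle Y A) (f : C(X, Y)) (γ : C(Simplex 1, X)) :
    c.comap f γ = c (f.comp γ) := rfl

instance : Zero (Cocycle X A) := ⟨⟨fun _ => 0, fun _ => (add_zero _).symm⟩⟩

instance : Add (Cocycle X A) :=
  ⟨fun c c' => ⟨fun γ => c γ + c' γ, fun σ => by rw [c.map_face, c'.map_face]; abel⟩⟩

instance : Sub (Cocycle X A) :=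
  ⟨fun c c' => ⟨fun γ => c γ - c' γ, fun σ => by rw [c.map_face, c'.map_face]; abel⟩⟩

@[simp] theorem zero_apply (γ : C(Simplex 1, X)) : (0 : Cocycle X A) γ = 0 := rfl

@[simp]
theorem add_apply (c c' : Cocycle X A) (γ : C(Simplex 1, X)) : (c + c') γ = c γ + c' γ := rfl

@[simp]
theorem sub_apply (c c' : Cocycle X A) (γ : C(Simplex 1, X)) : (c - c') γ = c γ - c' γ := rfl

/-- The coboundary of a function on points. -/
def coboundary (g : X → A) : Cocycle X A where
  toFun γ := g (γ (vtx 1)) - g (γ (vtx 0))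
  map_face σ := by
    simp only [ContinuousMap.comp_apply, face_vtx]
    have h1 : (1 : Fin 3).succAbove (1 : Fin 2) = 2 := rfl
    have h2 : (1 : Fin 3).succAbove (0 : Fin 2) = 0 := rfl
    have h3 : (0 : Fin 3).succAbove (1 : Fin 2) = 2 := rfl
    have h4 : (0 : Fin 3).succAbove (0 : Fin 2) = 1 := rfl
    have h5 : (2 : Fin 3).succAbove (1 : Fin 2) = 1 := rfl
    have h6 : (2 : Fin 3).succAbove (0 : Fin 2) = 0 := rfl
    rw [h1, h2, h3, h4, h5, h6]
    abel

@[simp]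
theorem coboundary_apply (g : X → A) (γ : C(Simplex 1, X)) :
    coboundary g γ = g (γ (vtx 1)) - g (γ (vtx 0)) := rfl

end Cocycle

/-- The singular simplicial set of `X`. -/
abbrev sing (X : Type) [TopologicalSpace X] : SSet := TopCat.toSSet.obj (TopCat.of X)

/-- The simplices of `sing X` are the continuous maps from the standard simplex to `X`. -/
def simplexEquiv (X : Type) [TopologicalSpace X] (n : ℕ) : (sing X) _⦋n⦌ ≃ C(Simplex n, X) :=
  (TopCat.of X).toSSetObjEquiv (.op ⦋n⦌)

theorem simplexEquiv_δ {n : ℕ} (i : Fin (n + 2)) (x : (sing X) _⦋n + 1⦌) :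
    simplexEquiv X n ((sing X).δ i x) = (simplexEquiv X (n + 1) x).comp (face i) := rfl

theorem simplexEquiv_map (f : C(X, Y)) {n : ℕ} (x : (sing X) _⦋n⦌) :
    simplexEquiv Y n ((TopCat.toSSet.map (TopCat.ofHom f)).app _ x) =
      f.comp (simplexEquiv X n x) := rfl

/-- The integral singular chain complex of `X`. -/
abbrev chains (X : Type) [TopologicalSpace X] : ChainComplex (ModuleCat ℤ) ℕ :=
  (sing X).chainComplex (ModuleCat.of ℤ ℤ)

variable [Module ℤ A]

/-- The homomorphism on chains determined by a function on singular simplices. -/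
def cochainHom {n : ℕ} (f : C(Simplex n, X) → A) : (chains X).X n ⟶ ModuleCat.of ℤ A :=
  Limits.Sigma.desc fun x : (sing X) _⦋n⦌ =>
    ModuleCat.ofHom (LinearMap.toSpanSingleton ℤ A (f (simplexEquiv X n x)))

theorem ι_cochainHom {n : ℕ} (f : C(Simplex n, X) → A) (x : (sing X) _⦋n⦌) :
    (sing X).ιChainComplex x ≫ cochainHom f =
      ModuleCat.ofHom (LinearMap.toSpanSingleton ℤ A (f (simplexEquiv X n x))) :=
  Limits.Sigma.ι_desc _ _

theorem exists_eq_cochainHom {n : ℕ} (k : (chains X).X n ⟶ ModuleCat.of ℤ A) :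
    ∃ f : C(Simplex n, X) → A, k = cochainHom f := by
  refine ⟨fun σ => ((sing X).ιChainComplex ((simplexEquiv X n).symm σ) ≫ k).hom (1 : ℤ), ?_⟩
  refine SSet.chainComplex_hom_ext fun x => ?_
  rw [ι_cochainHom]
  refine ModuleCat.hom_ext (LinearMap.ext_ring ?_)
  simp only [ModuleCat.hom_ofHom, Equiv.symm_apply_apply]
  exact (LinearMap.toSpanSingleton_apply_one _ _ _).symm

theorem ofHom_toSpanSingleton_injective {a b : A}
    (h : ModuleCat.ofHom (LinearMap.toSpanSingleton ℤ A a) =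
      ModuleCat.ofHom (LinearMap.toSpanSingleton ℤ A b)) : a = b := by
  have h1 : LinearMap.toSpanSingleton ℤ A a 1 = LinearMap.toSpanSingleton ℤ A b 1 :=
    congr_arg (fun φ => φ.hom (1 : ℤ)) h
  rwa [LinearMap.toSpanSingleton_apply_one, LinearMap.toSpanSingleton_apply_one] at h1

theorem toSpanSingleton_ofHom_add (a b : A) :
    ModuleCat.ofHom (LinearMap.toSpanSingleton ℤ A (a + b)) =
      ModuleCat.ofHom (LinearMap.toSpanSingleton ℤ A a) +
      ModuleCat.ofHom (LinearMap.toSpanSingleton ℤ A b) := by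
  exact ModuleCat.hom_ext (LinearMap.ext_ring (smul_add (1 : ℤ) a b))

theorem toSpanSingleton_ofHom_sub (a b : A) :
    ModuleCat.ofHom (LinearMap.toSpanSingleton ℤ A (a - b)) =
      ModuleCat.ofHom (LinearMap.toSpanSingleton ℤ A a) -
      ModuleCat.ofHom (LinearMap.toSpanSingleton ℤ A b) := by
  exact ModuleCat.hom_ext (LinearMap.ext_ring (smul_sub (1 : ℤ) a b))

theorem ι_d_one (x : (sing X) _⦋1⦌) : (sing X).ιChainComplex x ≫ (chains X).d 1 0 =
    (sing X).ιChainComplex ((sing X).δ 0 x) - (sing X).ιChainComplex ((sing X).δ 1 x) := by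
  rw [SSet.ιChainComplex_d, Fin.sum_univ_two]
  simp [sub_eq_add_neg]

theorem ι_d_two (x : (sing X) _⦋2⦌) : (sing X).ιChainComplex x ≫ (chains X).d 2 1 =
    (sing X).ιChainComplex ((sing X).δ 0 x) - (sing X).ιChainComplex ((sing X).δ 1 x) +
      (sing X).ιChainComplex ((sing X).δ 2 x) := by
  rw [SSet.ιChainComplex_d, Fin.sum_univ_three]
  simp [sub_eq_add_neg]

theorem d_cochainHom (c : Cocycle X A) : (chains X).d 2 1 ≫ cochainHom c = 0 := by
  refine SSet.chainComplex_hom_ext fun x => ?_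
  rw [← Category.assoc, ι_d_two, Preadditive.add_comp, Preadditive.sub_comp, ι_cochainHom,
    ι_cochainHom, ι_cochainHom, simplexEquiv_δ, simplexEquiv_δ, simplexEquiv_δ, c.map_face,
    toSpanSingleton_ofHom_add, Limits.comp_zero]
  abel

namespace Cocycle

/-- The evaluation of a cocycle on homology classes, as a morphism. -/
def evalHom (c : Cocycle X A) : (chains X).homology 1 ⟶ ModuleCat.of ℤ A :=
  (chains X).homologyι 1 ≫ (chains X).descOpcycles (cochainHom c) 2 (by simp) (d_cochainHom c)

/-- The evaluation of a cocycle on homology classes. -/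
def eval (c : Cocycle X A) : H1 ℤ X →ₗ[ℤ] A := c.evalHom.hom

theorem π_evalHom (c : Cocycle X A) :
    (chains X).homologyπ 1 ≫ c.evalHom = (chains X).iCycles 1 ≫ cochainHom c := by
  simp [evalHom]

theorem eval_comap (c : Cocycle Y A) (f : C(X, Y)) :
    (c.comap f).eval = c.eval ∘ₗ H1map ℤ f := by
  have h : (c.comap f).evalHom = HomologicalComplex.homologyMap
      (SSet.chainComplexMap (TopCat.toSSet.map (TopCat.ofHom f)) (ModuleCat.of ℤ ℤ)) 1 ≫
        c.evalHom := by
    rw [← cancel_epi ((chains X).homologyπ 1), π_evalHom, HomologicalComplex.homologyπ_naturality_assoc,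
      π_evalHom, HomologicalComplex.cyclesMap_i_assoc]
    congr 1
    refine SSet.chainComplex_hom_ext fun x => ?_
    rw [ι_cochainHom, SSet.ι_chainComplexMap_f_assoc, ι_cochainHom, simplexEquiv_map]
    rfl
  exact congr_arg ModuleCat.Hom.hom h

theorem eval_add (c c' : Cocycle X A) : (c + c').eval = c.eval + c'.eval := by
  have h : (c + c').evalHom = c.evalHom + c'.evalHom := by
    rw [← cancel_epi ((chains X).homologyπ 1), Preadditive.comp_add, π_evalHom, π_evalHom,
      π_evalHom, ← Preadditive.comp_add]
    congr 1
    refine SSet.chainComplex_hom_ext fun x => ?_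
    rw [Preadditive.comp_add, ι_cochainHom, ι_cochainHom, ι_cochainHom,
      ← toSpanSingleton_ofHom_add, add_apply]
  exact congr_arg ModuleCat.Hom.hom h

theorem eval_sub (c c' : Cocycle X A) : (c - c').eval = c.eval - c'.eval := by
  have h : c - c' + c' = c := by ext; simp
  rw [eq_sub_iff_add_eq, ← eval_add, h]

theorem cochainHom_coboundary (g : X → A) :
    cochainHom (coboundary g) =
      (chains X).d 1 0 ≫ cochainHom fun σ : C(Simplex 0, X) => g (σ (vtx 0)) := by
  refine SSet.chainComplex_hom_ext fun x => ?_
  rw [← Category.assoc, ι_d_one, Preadditive.sub_comp, ι_cochainHom, ι_cochainHom, ι_cochainHom,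
    ← toSpanSingleton_ofHom_sub, simplexEquiv_δ, simplexEquiv_δ, coboundary_apply]
  simp only [ContinuousMap.comp_apply, face_vtx]
  rfl

theorem eval_coboundary (g : X → A) : (coboundary g).eval = 0 := by
  have h : (coboundary g).evalHom = 0 := by
    rw [← cancel_epi ((chains X).homologyπ 1), π_evalHom, cochainHom_coboundary]
    simp
  exact congr_arg ModuleCat.Hom.hom h

end Cocycle

/-- The constant singular 0-simplex at a point. -/
def pointSimplex (x : X) : (sing X) _⦋0⦌ := (simplexEquiv X 0).symm (ContinuousMap.const _ x)

theorem pointSimplex_eq (y : (sing X) _⦋0⦌) :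
    pointSimplex (simplexEquiv X 0 y (vtx 0)) = y := by
  rw [pointSimplex, Equiv.symm_apply_eq]
  ext z
  rw [ContinuousMap.const_apply, Subsingleton.elim z (vtx 0)]

/-- A path parametrized by the standard 1-simplex. -/
def pathSimplex {x y : X} (p : Path x y) : C(Simplex 1, X) :=
  p.toContinuousMap.comp ⟨stdSimplexHomeomorphUnitInterval,
    stdSimplexHomeomorphUnitInterval.continuous⟩

theorem pathSimplex_zero {x y : X} (p : Path x y) : pathSimplex p (vtx 0) = x := by
  exact (congr_arg p stdSimplexHomeomorphUnitInterval_zero).trans p.source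

theorem pathSimplex_one {x y : X} (p : Path x y) : pathSimplex p (vtx 1) = y := by
  exact (congr_arg p stdSimplexHomeomorphUnitInterval_one).trans p.target

theorem joined_of_simplex (γ : C(Simplex 1, X)) : Joined (γ (vtx 0)) (γ (vtx 1)) :=
  (PathConnectedSpace.joined (vtx (n := 1) 0) (vtx 1)).map γ.continuous

/-- Paths from a base point of each path component: the chosen base point depends only on the path
component. -/
theorem exists_paths (X : Type) [TopologicalSpace X] :
    ∃ (b : X → X) (p : X → C(Simplex 1, X)), (∀ x, p x (vtx 0) = b x) ∧ (∀ x, p x (vtx 1) = x) ∧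
      ∀ γ : C(Simplex 1, X), b (γ (vtx 0)) = b (γ (vtx 1)) := by
  have hj : ∀ x : X, Joined (Quotient.out (s := pathSetoid X) (Quotient.mk _ x)) x := fun x =>
    Quotient.exact (s := pathSetoid X) (Quotient.out_eq _)
  refine ⟨fun x => Quotient.out (s := pathSetoid X) (Quotient.mk _ x),
    fun x => pathSimplex (hj x).somePath, fun x => pathSimplex_zero _,
    fun x => pathSimplex_one _, fun γ => ?_⟩
  exact congr_arg _ (Quotient.sound (s := pathSetoid X) (joined_of_simplex γ))

/-- A partial inverse of the boundary map in degree one: it sends a point to a path that joins it to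
the base point of its path component.  It provides a projection of the 1-chains to the 1-cycles, so
that homomorphisms on cycles extend to chains. -/
theorem exists_chain_section (X : Type) [TopologicalSpace X] :
    ∃ h : (chains X).X 0 ⟶ (chains X).X 1,
      (chains X).d 1 0 ≫ h ≫ (chains X).d 1 0 = (chains X).d 1 0 := by
  obtain ⟨b, p, hp0, hp1, hb⟩ := exists_paths X
  let h : (chains X).X 0 ⟶ (chains X).X 1 := Limits.Sigma.desc fun y : (sing X) _⦋0⦌ =>
    (sing X).ιChainComplex ((simplexEquiv X 1).symm (p (simplexEquiv X 0 y (vtx 0))))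
  have hι : ∀ y : (sing X) _⦋0⦌, (sing X).ιChainComplex y ≫ h =
      (sing X).ιChainComplex ((simplexEquiv X 1).symm (p (simplexEquiv X 0 y (vtx 0)))) :=
    fun y => Limits.Sigma.ι_desc _ _
  refine ⟨h, SSet.chainComplex_hom_ext fun x => ?_⟩
  have key : ∀ y : (sing X) _⦋0⦌, (sing X).ιChainComplex y ≫ h ≫ (chains X).d 1 0 =
      (sing X).ιChainComplex y -
        (sing X).ιChainComplex (pointSimplex (b (simplexEquiv X 0 y (vtx 0)))) := by
    intro y
    rw [← Category.assoc, hι, ι_d_one]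
    congr 2
    · rw [← pointSimplex_eq ((sing X).δ 0 _), simplexEquiv_δ, Equiv.apply_symm_apply,
        ContinuousMap.comp_apply, face_vtx]
      exact (congr_arg pointSimplex (hp1 _)).trans (pointSimplex_eq y)
    · rw [← pointSimplex_eq ((sing X).δ 1 _), simplexEquiv_δ, Equiv.apply_symm_apply,
        ContinuousMap.comp_apply, face_vtx]
      exact congr_arg pointSimplex (hp0 _)
  rw [← Category.assoc, ι_d_one, Preadditive.sub_comp, key, key]
  have h2 : simplexEquiv X 0 ((sing X).δ 0 x) (vtx 0) = simplexEquiv X 1 x (vtx 1) := by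
    rw [simplexEquiv_δ, ContinuousMap.comp_apply, face_vtx]; rfl
  have h3 : simplexEquiv X 0 ((sing X).δ 1 x) (vtx 0) = simplexEquiv X 1 x (vtx 0) := by
    rw [simplexEquiv_δ, ContinuousMap.comp_apply, face_vtx]; rfl
  rw [h2, h3, hb]
  abel

theorem eq_cochainHom_comp (k : (chains X).X 1 ⟶ ModuleCat.of ℤ A)
    (hk : (chains X).d 2 1 ≫ k = 0) : ∃ c : Cocycle X A, k = cochainHom c := by
  obtain ⟨f, rfl⟩ := exists_eq_cochainHom k
  refine ⟨⟨f, fun σ => ?_⟩, rfl⟩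
  have h := congr_arg (CategoryStruct.comp ((sing X).ιChainComplex ((simplexEquiv X 2).symm σ))) hk
  simp only [← Category.assoc, ι_d_two, Preadditive.add_comp, Preadditive.sub_comp, ι_cochainHom,
    simplexEquiv_δ, Equiv.apply_symm_apply, Limits.comp_zero] at h
  rw [← toSpanSingleton_ofHom_sub, ← toSpanSingleton_ofHom_add] at h
  have h0 := ofHom_toSpanSingleton_injective (b := (0 : A))
    (h.trans (by refine ModuleCat.hom_ext (LinearMap.ext_ring ?_); simp))
  rw [← sub_eq_zero, ← neg_eq_zero, ← h0]
  abel

/-- Every homomorphism on `H₁` is the evaluation of a cocycle. -/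
theorem exists_cocycle_eval_eq (φ : H1 ℤ X →ₗ[ℤ] A) : ∃ c : Cocycle X A, c.eval = φ := by
  obtain ⟨h, hh⟩ := exists_chain_section X
  let e : (chains X).X 1 ⟶ (chains X).X 1 := 𝟙 _ - (chains X).d 1 0 ≫ h
  have he : e ≫ (chains X).d 1 0 = 0 := by
    simp only [e, Preadditive.sub_comp, Category.id_comp, Category.assoc, hh, sub_self]
  have hie : (chains X).iCycles 1 ≫ e = (chains X).iCycles 1 := by
    simp [e, Preadditive.comp_sub]
  let r := (chains X).liftCycles e 0 (by simp) he
  have hir : (chains X).iCycles 1 ≫ r = 𝟙 _ := by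
    rw [← cancel_mono ((chains X).iCycles 1)]
    simp [r, hie]
  let φ' : (chains X).homology 1 ⟶ ModuleCat.of ℤ A := ModuleCat.ofHom φ
  obtain ⟨c, hc⟩ := eq_cochainHom_comp (r ≫ (chains X).homologyπ 1 ≫ φ') (by
    have : (chains X).d 2 1 ≫ r = (chains X).toCycles 2 1 := by
      rw [← cancel_mono ((chains X).iCycles 1)]
      simp [r, e, Preadditive.comp_sub]
    rw [← Category.assoc, this]
    simp)
  refine ⟨c, ?_⟩
  have : c.evalHom = φ' := by
    rw [← cancel_epi ((chains X).homologyπ 1), Cocycle.π_evalHom, ← hc, ← Category.assoc, hir,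
      Category.id_comp]
  exact congr_arg ModuleCat.Hom.hom this

/-- A cocycle that vanishes on `H₁` is a coboundary. -/
theorem Cocycle.exists_eq_coboundary (c : Cocycle X A) (hc : c.eval = 0) :
    ∃ g : X → A, c = coboundary g := by
  obtain ⟨h, hh⟩ := exists_chain_section X
  let e : (chains X).X 1 ⟶ (chains X).X 1 := 𝟙 _ - (chains X).d 1 0 ≫ h
  have he : e ≫ (chains X).d 1 0 = 0 := by
    simp only [e, Preadditive.sub_comp, Category.id_comp, Category.assoc, hh, sub_self]
  have hc' : c.evalHom = 0 := ModuleCat.hom_ext hc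
  have hk : e ≫ cochainHom c = 0 := by
    have : e = (chains X).liftCycles e 0 (by simp) he ≫ (chains X).iCycles 1 := by simp
    rw [this, Category.assoc, ← Cocycle.π_evalHom, hc']
    simp
  have hk' : cochainHom c = (chains X).d 1 0 ≫ h ≫ cochainHom c := by
    simp only [e, Preadditive.sub_comp, Category.id_comp, Category.assoc] at hk
    exact sub_eq_zero.1 hk
  obtain ⟨f, hf⟩ := exists_eq_cochainHom (h ≫ cochainHom c)
  refine ⟨fun x => f (ContinuousMap.const _ x), ?_⟩
  have hfe : f = fun σ : C(Simplex 0, X) => f (ContinuousMap.const _ (σ (vtx 0))) := by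
    funext σ
    congr 1
    ext z
    rw [ContinuousMap.const_apply, Subsingleton.elim z (vtx 0)]
  rw [hf, hfe, ← Cocycle.cochainHom_coboundary fun x => f (ContinuousMap.const _ x)] at hk'
  ext γ
  have h2 := congr_arg (CategoryStruct.comp ((sing X).ιChainComplex ((simplexEquiv X 1).symm γ))) hk'
  simp only [ι_cochainHom, Equiv.apply_symm_apply] at h2
  exact ofHom_toSpanSingleton_injective h2

/-! ### Functoriality and homotopy invariance -/

theorem H1map_comp (g : C(Y, Z)) (f : C(X, Y)) : H1map ℤ (g.comp f) = H1map ℤ g ∘ₗ H1map ℤ f := by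
  unfold H1map
  rw [TopCat.ofHom_comp, Functor.map_comp, ModuleCat.hom_comp]

theorem H1map_id : H1map ℤ (ContinuousMap.id X) = LinearMap.id := by
  unfold H1map
  rw [TopCat.ofHom_id, CategoryTheory.Functor.map_id, ModuleCat.hom_id]

theorem H1map_bijective_of_homeomorph (h : X ≃ₜ Y) : Function.Bijective (H1map ℤ (h : C(X, Y))) := by
  have h1 : (h.symm : C(Y, X)).comp (h : C(X, Y)) = ContinuousMap.id X := by ext x; simp
  have h2 : (h : C(X, Y)).comp (h.symm : C(Y, X)) = ContinuousMap.id Y := by ext x; simp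
  have h1' : (H1map ℤ (h.symm : C(Y, X))).comp (H1map ℤ (h : C(X, Y))) = LinearMap.id := by
    rw [← H1map_comp, h1, H1map_id]
  have h2' : (H1map ℤ (h : C(X, Y))).comp (H1map ℤ (h.symm : C(Y, X))) = LinearMap.id := by
    rw [← H1map_comp, h2, H1map_id]
  exact ⟨Function.LeftInverse.injective fun x => LinearMap.congr_fun h1' x,
    Function.RightInverse.surjective fun x => LinearMap.congr_fun h2' x⟩

theorem H1map_eq_of_homotopic {f g : C(X, Y)} (h : f.Homotopic g) : H1map ℤ f = H1map ℤ g := by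
  obtain ⟨F⟩ := h
  exact congr_arg ModuleCat.Hom.hom
    (TopCat.Homotopy.congr_homologyMap_singularChainComplexFunctor
      (f := TopCat.ofHom f) (g := TopCat.ofHom g) F (ModuleCat.of ℤ ℤ) 1)

theorem subsingleton_H1_of_subsingleton [Subsingleton X] : Subsingleton (H1 ℤ X) :=
  ModuleCat.subsingleton_of_isZero
    (AlgebraicTopology.isZero_singularHomologyFunctor_of_totallyDisconnectedSpace
      (ModuleCat ℤ) 1 (ModuleCat.of ℤ ℤ) (TopCat.of X) one_ne_zero)

theorem H1map_const (y : Y) : H1map ℤ (ContinuousMap.const X y) = 0 := by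
  have h : ContinuousMap.const X y =
    (ContinuousMap.const Unit y).comp (ContinuousMap.const X ()) := rfl
  rw [h, H1map_comp]
  have := subsingleton_H1_of_subsingleton (X := Unit)
  ext x
  simp [Subsingleton.elim (H1map ℤ (ContinuousMap.const X ()) x) 0]

theorem Cocycle.exists_eq_coboundary_of_contractible {A : Type} [AddCommGroup A]
    [ContractibleSpace X] (c : Cocycle X A) : ∃ g : X → A, c = coboundary g := by
  refine c.exists_eq_coboundary ?_
  obtain ⟨x, hx⟩ := (contractible_iff_id_nullhomotopic X).1 inferInstance
  have h : c.eval = c.eval ∘ₗ H1map ℤ (ContinuousMap.id X) := by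
    rw [H1map_id, LinearMap.comp_id]
  rw [h, H1map_eq_of_homotopic hx, H1map_const, LinearMap.comp_zero]

end Cocycle

/-! ### Gluing cocycles over an open cover -/

/-- The affine map between standard simplices with prescribed values on the vertices. -/
def affineSimplex {m n : ℕ} (v : Fin (m + 1) → Simplex n) : C(Simplex m, Simplex n) where
  toFun s := ⟨∑ i, s i • (v i : Fin (n + 1) → ℝ),
    (convex_stdSimplex ℝ (Fin (n + 1))).sum_mem (fun i _ => stdSimplex.zero_le s i)
      (stdSimplex.sum_eq_one s) fun i _ => (v i).2⟩
  continuous_toFun := by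
    refine Continuous.subtype_mk (continuous_finsetSum _ fun i _ => ?_) _
    exact ((continuous_apply i).comp continuous_subtype_val).smul continuous_const

theorem affineSimplex_coe {m n : ℕ} (v : Fin (m + 1) → Simplex n) (s : Simplex m) :
    (affineSimplex v s).1 = ∑ i, s i • (v i).1 := rfl

theorem vtx_apply_self {n : ℕ} (i : Fin (n + 1)) : (vtx i : Simplex n) i = 1 := by
  rw [stdSimplex.vertex_coe, Pi.single_eq_same]

theorem vtx_apply_of_ne {n : ℕ} {i j : Fin (n + 1)} (h : j ≠ i) : (vtx i : Simplex n) j = 0 := by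
  rw [stdSimplex.vertex_coe, Pi.single_eq_of_ne h]

theorem affineSimplex_vtx {m n : ℕ} (v : Fin (m + 1) → Simplex n) (i : Fin (m + 1)) :
    affineSimplex v (vtx i) = v i := by
  apply Subtype.ext
  rw [affineSimplex_coe, Finset.sum_eq_single i]
  · rw [vtx_apply_self, one_smul]
  · intro j _ hj
    rw [vtx_apply_of_ne hj, zero_smul]
  · simp

theorem face_apply_self {n : ℕ} (i : Fin (n + 2)) (s : Simplex n) : face i s i = 0 := by
  change FunOnFinite.linearMap ℝ ℝ i.succAbove s i = 0
  rw [FunOnFinite.linearMap_apply_apply]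
  exact Finset.sum_eq_zero fun j hj => absurd (Finset.mem_filter.1 hj).2 (Fin.succAbove_ne i j)

theorem face_apply_succAbove {n : ℕ} (i : Fin (n + 2)) (s : Simplex n) (j : Fin (n + 1)) :
    face i s (i.succAbove j) = s j := by
  change FunOnFinite.linearMap ℝ ℝ i.succAbove s (i.succAbove j) = s j
  rw [FunOnFinite.linearMap_apply_apply]
  simp [Finset.filter_eq']

theorem affineSimplex_comp_face {m n : ℕ} (v : Fin (m + 2) → Simplex n) (i : Fin (m + 2)) :
    (affineSimplex v).comp (face i) = affineSimplex (v ∘ i.succAbove) := by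
  ext s : 1
  apply Subtype.ext
  rw [ContinuousMap.comp_apply, affineSimplex_coe, affineSimplex_coe, Fin.sum_univ_succAbove _ i,
    face_apply_self, zero_smul, zero_add]
  simp only [face_apply_succAbove, Function.comp_apply]

theorem face_comp_affineSimplex {m n : ℕ} (v : Fin (m + 1) → Simplex n) (i : Fin (n + 2)) :
    (face i).comp (affineSimplex v) = affineSimplex (face i ∘ v) := by
  ext s : 1
  apply Subtype.ext
  change FunOnFinite.linearMap ℝ ℝ i.succAbove (affineSimplex v s).1 = _
  rw [affineSimplex_coe, affineSimplex_coe, map_sum]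
  refine Finset.sum_congr rfl fun j _ => ?_
  rw [map_smul]
  rfl

theorem dist_affineSimplex_lt {m n : ℕ} {v : Fin (m + 1) → Simplex n} {y : Simplex n} {δ : ℝ}
    (h : ∀ i, dist (v i) y < δ) (s : Simplex m) : dist (affineSimplex v s) y < δ := by
  have := (convex_ball (y : Fin (n + 1) → ℝ) δ).sum_mem (t := Finset.univ) (w := fun i => s i)
    (z := fun i => (v i : Fin (n + 1) → ℝ)) (fun i _ => stdSimplex.zero_le s i)
    (stdSimplex.sum_eq_one s) fun i _ => h i
  exact this

theorem dist_simplex_le_one {n : ℕ} (x y : Simplex n) : dist x y ≤ 1 :=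
  (dist_le_diam_of_mem (bounded_stdSimplex _) x.2 y.2).trans diam_stdSimplex_le

/-- A function of pairs of nearby points of a simplex that is additive on small triangles is the
difference of the values of a function.  The function is obtained by summation along a fine
subdivision of the segment from a vertex; telescoping over the thin quadrilaterals between two such
segments gives the claim. -/
theorem exists_primitive_of_additive {n : ℕ} {A : Type} [AddCommGroup A]
    (d : Simplex n → Simplex n → A) {δ : ℝ} (hδ : 0 < δ)
    (hd : ∀ x y z, dist x y < δ → dist y z < δ → dist x z < δ → d x y + d y z = d x z) :
    ∃ f : Simplex n → A, ∀ x y, dist x y < δ / 2 → f y - f x = d x y := by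
  obtain ⟨N, hN⟩ := exists_nat_gt (2 / δ)
  have hN0 : (0 : ℝ) < N := (div_pos two_pos hδ).trans hN
  have hN' : 1 / (N : ℝ) < δ / 2 := by
    rw [div_lt_iff₀ hδ] at hN
    rw [div_lt_div_iff₀ hN0 two_pos]
    linarith
  let p : Simplex n := vtx 0
  let τ : ℕ → ℝ := fun k => min 1 (k / N)
  have hτ0 : ∀ k, 0 ≤ τ k := fun k => le_min zero_le_one (by positivity)
  have hτ1 : ∀ k, τ k ≤ 1 := fun k => min_le_left _ _
  let pt : ℕ → Simplex n → Simplex n := fun k x => ⟨(1 - τ k) • p.1 + τ k • x.1,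
    convex_stdSimplex ℝ _ p.2 x.2 (sub_nonneg.2 (hτ1 k)) (hτ0 k) (by ring)⟩
  have hpt : ∀ k x, (pt k x).1 = (1 - τ k) • p.1 + τ k • x.1 := fun _ _ => rfl
  have hstep : ∀ k x, dist (pt k x) (pt (k + 1) x) < δ / 2 := by
    intro k x
    have h1 : |τ k - τ (k + 1)| ≤ 1 / N := by
      refine (abs_min_sub_min_le_max _ _ _ _).trans (max_le (by simp) ?_)
      rw [abs_sub_comm, ← sub_div]
      simp
    have h2 : dist (pt k x) (pt (k + 1) x) = |τ k - τ (k + 1)| * dist x p := by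
      rw [Subtype.dist_eq, Subtype.dist_eq, dist_eq_norm, dist_eq_norm, hpt, hpt, ← Real.norm_eq_abs,
        ← norm_smul]
      congr 1
      module
    rw [h2]
    calc |τ k - τ (k + 1)| * dist x p ≤ |τ k - τ (k + 1)| * 1 :=
          mul_le_mul_of_nonneg_left (dist_simplex_le_one _ _) (abs_nonneg _)
      _ < δ / 2 := by rw [mul_one]; exact h1.trans_lt hN'
  have hside : ∀ k x y, dist (pt k x) (pt k y) ≤ dist x y := by
    intro k x y
    have h2 : dist (pt k x) (pt k y) = τ k * dist x y := by
      rw [Subtype.dist_eq, Subtype.dist_eq, dist_eq_norm, dist_eq_norm, hpt, hpt,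
        ← Real.norm_of_nonneg (hτ0 k), ← norm_smul, Real.norm_of_nonneg (hτ0 k)]
      congr 1
      module
    rw [h2]
    exact mul_le_of_le_one_left dist_nonneg (hτ1 k)
  have hself : ∀ x, d x x = 0 := fun x => by
    have := hd x x x (by simpa) (by simpa) (by simpa)
    simpa using this
  refine ⟨fun x => ∑ k ∈ Finset.range N, d (pt k x) (pt (k + 1) x), fun x y hxy => ?_⟩
  have hsum : ∀ M : ℕ, ∑ k ∈ Finset.range M, d (pt k y) (pt (k + 1) y) -
      ∑ k ∈ Finset.range M, d (pt k x) (pt (k + 1) x) =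
        d (pt M x) (pt M y) - d (pt 0 x) (pt 0 y) := by
    intro M
    induction M with
    | zero => simp
    | succ M ih =>
      rw [Finset.sum_range_succ, Finset.sum_range_succ]
      have hs := hstep M x
      have hs' := hstep M y
      have h3 := hside M x y
      have h4 := hside (M + 1) x y
      have hdiag : dist (pt M x) (pt (M + 1) y) < δ := by
        have := dist_triangle (pt M x) (pt M y) (pt (M + 1) y)
        linarith
      have e1 := hd (pt M x) (pt M y) (pt (M + 1) y) (by linarith) (by linarith) hdiag
      have e2 := hd (pt M x) (pt (M + 1) x) (pt (M + 1) y) (by linarith) (by linarith) hdiag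
      rw [add_sub_add_comm, ih]
      have e3 := e1.trans e2.symm
      have e4 : d (pt M y) (pt (M + 1) y) = d (pt M x) (pt (M + 1) x) +
          d (pt (M + 1) x) (pt (M + 1) y) - d (pt M x) (pt M y) := by
        rw [← e3]; abel
      rw [e4]
      abel
  have hp0 : ∀ x, pt 0 x = p := fun x => by
    apply Subtype.ext
    rw [hpt]
    simp [τ]
  have hpN : ∀ x, pt N x = x := fun x => by
    apply Subtype.ext
    rw [hpt]
    simp [τ, hN0.ne']
  rw [hsum, hp0, hp0, hpN, hpN, hself, sub_zero]

section Glue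

variable {X : Type} [TopologicalSpace X] {A : Type} [AddCommGroup A]

/-- The restriction of the target of a continuous map to a subset containing its range. -/
def restr {Y : Type} [TopologicalSpace Y] {W : Set X} (γ : C(Y, X)) (h : ∀ s, γ s ∈ W) : C(Y, W) :=
  ⟨fun s => ⟨γ s, h s⟩, γ.continuous.subtype_mk _⟩

/-- The inclusion of a subset as a continuous map. -/
def incl (W : Set X) : C(W, X) := ⟨Subtype.val, continuous_subtype_val⟩

variable {ι : Type} {W : ι → Set X}

/-- The cocycles `c i` on the sets `W i` have the same value on every path that lies in two of
these sets. -/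
def Compatible (c : ∀ i, Cocycle (W i) A) : Prop :=
  ∀ i j (γ : C(Simplex 1, X)) (hi : ∀ s, γ s ∈ W i) (hj : ∀ s, γ s ∈ W j),
    c i (restr γ hi) = c j (restr γ hj)

/-- The function `f` on the standard simplex is a primitive of the pullback by `h` of the family of
local cocycles `c`, tested on short straight segments. -/
def IsPrimitive (c : ∀ i, Cocycle (W i) A) {n : ℕ} (h : C(Simplex n, X)) (f : Simplex n → A) :
    Prop :=
  ∀ y, ∀ᶠ z in 𝓝 y, ∀ i (hi : ∀ s, h (affineSimplex ![y, z] s) ∈ W i),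
    f z - f y = c i (restr (h.comp (affineSimplex ![y, z])) hi)

theorem exists_lebesgue (hW : ∀ i, IsOpen (W i)) (hcov : ∀ x, ∃ i, x ∈ W i) {n : ℕ}
    (h : C(Simplex n, X)) : ∃ δ > 0, ∀ y, ∃ i, ∀ z, dist z y < δ → h z ∈ W i := by
  obtain ⟨δ, hδ, H⟩ := lebesgue_number_lemma_of_metric (isCompact_univ (X := Simplex n))
    (c := fun i => h ⁻¹' W i) (fun i => (hW i).preimage h.continuous) fun y _ => by
      obtain ⟨i, hi⟩ := hcov (h y)
      exact mem_iUnion.2 ⟨i, hi⟩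
  exact ⟨δ, hδ, fun y => (H y trivial).imp fun i hi z hz => hi hz⟩

theorem dist_segment_lt {n : ℕ} {x y z : Simplex n} {δ : ℝ} (h1 : dist y x < δ) (h2 : dist z x < δ)
    (s : Simplex 1) : dist (affineSimplex ![y, z] s) x < δ :=
  dist_affineSimplex_lt (fun i => by fin_cases i; exacts [h1, h2]) s

/-- A primitive exists because, below a Lebesgue number of the cover, compatibility makes the local
cocycles a well-defined function of pairs of points that is additive on small triangles. -/
theorem exists_isPrimitive (hW : ∀ i, IsOpen (W i)) (hcov : ∀ x, ∃ i, x ∈ W i)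
    {c : ∀ i, Cocycle (W i) A} (hc : Compatible c) {n : ℕ} (h : C(Simplex n, X)) :
    ∃ f, IsPrimitive c h f := by
  obtain ⟨δ, hδ, H⟩ := exists_lebesgue hW hcov h
  choose i hi using H
  have hseg : ∀ y z, dist y z < δ → ∀ s, h (affineSimplex ![y, z] s) ∈ W (i y) := fun y z hyz s =>
    hi y _ (dist_segment_lt (by simpa) (by rwa [dist_comm]) s)
  classical
  let d : Simplex n → Simplex n → A := fun y z =>
    if hyz : dist y z < δ then c (i y) (restr (h.comp (affineSimplex ![y, z])) (hseg y z hyz)) else 0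
  have hd : ∀ y z (_ : dist y z < δ) j (hj : ∀ s, h (affineSimplex ![y, z] s) ∈ W j),
      d y z = c j (restr (h.comp (affineSimplex ![y, z])) hj) := fun y z hyz j hj => by
    simp only [d, dif_pos hyz]
    exact hc _ _ (h.comp (affineSimplex ![y, z])) _ _
  obtain ⟨f, hf⟩ := exists_primitive_of_additive d hδ fun x y z hxy hyz hxz => by
    have h1 : dist y x < δ := by rwa [dist_comm]
    have h2 : dist z x < δ := by rwa [dist_comm]
    have h0 : dist x x < δ := by simpa
    have htri : ∀ s, h (affineSimplex ![x, y, z] s) ∈ W (i x) := fun s =>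
      hi x _ (dist_affineSimplex_lt (fun j => by fin_cases j; exacts [h0, h1, h2]) s)
    have hm := (c (i x)).map_face (restr (h.comp (affineSimplex ![x, y, z])) htri)
    rw [hd x y hxy (i x) (hseg x y hxy), hd x z hxz (i x) (hseg x z hxz),
      hd y z hyz (i x) fun s => hi x _ (dist_segment_lt h1 h2 s), add_comm]
    have e0 : (affineSimplex ![x, y, z]).comp (face 0) = affineSimplex ![y, z] := by
      rw [affineSimplex_comp_face]; congr 1
    have e1 : (affineSimplex ![x, y, z]).comp (face 1) = affineSimplex ![x, z] := by
      rw [affineSimplex_comp_face]; congr 1; ext j; fin_cases j <;> rfl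
    have e2 : (affineSimplex ![x, y, z]).comp (face 2) = affineSimplex ![x, y] := by
      rw [affineSimplex_comp_face]; congr 1; ext j; fin_cases j <;> rfl
    refine Eq.symm (Eq.trans ?_ (hm.trans ?_))
    · congr 1; ext s; exact congr_arg h (DFunLike.congr_fun e1 s).symm
    · congr 2
      · ext s; exact congr_arg h (DFunLike.congr_fun e0 s)
      · ext s; exact congr_arg h (DFunLike.congr_fun e2 s)
  refine ⟨f, fun y => ?_⟩
  filter_upwards [ball_mem_nhds y (half_pos hδ)] with z hz j hj
  have hyz : dist y z < δ / 2 := by rw [dist_comm]; exact hz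
  rw [hf y z hyz, hd y z (hyz.trans (half_lt_self hδ)) j hj]

/-- A primitive is unique up to a constant, because the standard simplex is connected. -/
theorem IsPrimitive.sub_eq (hW : ∀ i, IsOpen (W i)) (hcov : ∀ x, ∃ i, x ∈ W i)
    {c : ∀ i, Cocycle (W i) A} {n : ℕ} {h : C(Simplex n, X)} {f f' : Simplex n → A}
    (hf : IsPrimitive c h f) (hf' : IsPrimitive c h f') (y z : Simplex n) :
    f z - f y = f' z - f' y := by
  obtain ⟨δ, hδ, H⟩ := exists_lebesgue hW hcov h
  have hl : IsLocallyConstant fun y => f y - f' y := by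
    rw [IsLocallyConstant.iff_eventually_eq]
    intro y
    filter_upwards [hf y, hf' y, ball_mem_nhds y hδ] with z h1 h2 h3
    obtain ⟨i, hi⟩ := H y
    have hs : ∀ s, h (affineSimplex ![y, z] s) ∈ W i := fun s =>
      hi _ (dist_segment_lt (by simpa) h3 s)
    have := (h1 i hs).trans (h2 i hs).symm
    rw [sub_eq_sub_iff_sub_eq_sub]
    exact this
  have := hl.apply_eq_of_preconnectedSpace z y
  rw [sub_eq_sub_iff_sub_eq_sub]
  exact this

theorem IsPrimitive.face {c : ∀ i, Cocycle (W i) A} {n : ℕ} {h : C(Simplex (n + 1), X)}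
    {f : Simplex (n + 1) → A} (hf : IsPrimitive c h f) (j : Fin (n + 2)) :
    IsPrimitive c (h.comp (face j)) (f ∘ face j) := by
  intro y
  filter_upwards [(SLCount.face j).continuous.continuousAt.eventually (hf (SLCount.face j y))]
    with z hz i hi
  have e : (SLCount.face j).comp (affineSimplex ![y, z]) =
      affineSimplex ![SLCount.face j y, SLCount.face j z] := by
    rw [face_comp_affineSimplex]; congr 1; ext k; fin_cases k <;> rfl
  have e' : ∀ s, SLCount.face j (affineSimplex ![y, z] s) =
      affineSimplex ![SLCount.face j y, SLCount.face j z] s := fun s => DFunLike.congr_fun e s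
  refine (hz i fun s => by rw [← e']; exact hi s).trans ?_
  congr 1
  ext s
  exact congr_arg h (e' s).symm

instance (n : ℕ) : ContractibleSpace (Simplex n) :=
  (convex_stdSimplex ℝ (Fin (n + 1))).contractibleSpace ⟨_, (vtx 0 : Simplex n).2⟩

/-- A cocycle has a primitive along every path. -/
theorem Cocycle.exists_primitive (c : Cocycle X A) (γ : C(Simplex 1, X)) :
    ∃ g : Simplex 1 → A, c γ = g (vtx 1) - g (vtx 0) ∧
      ∀ y z, g z - g y = c (γ.comp (affineSimplex ![y, z])) := by
  obtain ⟨g, hg⟩ := (c.comap γ).exists_eq_coboundary_of_contractible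
  refine ⟨g, ?_, fun y z => ?_⟩
  · exact congr_arg (fun c' : Cocycle (Simplex 1) A => c' (ContinuousMap.id _)) hg
  · have := congr_arg (fun c' : Cocycle (Simplex 1) A => c' (affineSimplex ![y, z])) hg
    simp only [Cocycle.comap_apply, Cocycle.coboundary_apply, affineSimplex_vtx] at this
    exact this.symm

/-- Compatible cocycles on the members of an open cover come from a cocycle on the whole space: its
value on a path is the difference of the values of a primitive at the two ends. -/
theorem exists_glue (hW : ∀ i, IsOpen (W i)) (hcov : ∀ x, ∃ i, x ∈ W i)
    {c : ∀ i, Cocycle (W i) A} (hc : Compatible c) :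
    ∃ c' : Cocycle X A, ∀ i, c'.comap (incl (W i)) = c i := by
  choose f hf using fun γ : C(Simplex 1, X) => exists_isPrimitive hW hcov hc γ
  refine ⟨⟨fun γ => f γ (vtx 1) - f γ (vtx 0), fun σ => ?_⟩, fun i => ?_⟩
  · obtain ⟨g, hg⟩ := exists_isPrimitive hW hcov hc σ
    have key : ∀ j, f (σ.comp (face j)) (vtx 1) - f (σ.comp (face j)) (vtx 0) =
        Cocycle.coboundary g (face j) := fun j => by
      rw [(hf (σ.comp (face j))).sub_eq hW hcov (hg.face j)]
      rfl
    rw [key, key, key]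
    exact (Cocycle.coboundary g).map_face (ContinuousMap.id _)
  · ext γ
    obtain ⟨g, hg, hg'⟩ := (c i).exists_primitive γ
    change f ((incl (W i)).comp γ) (vtx 1) - f ((incl (W i)).comp γ) (vtx 0) = c i γ
    rw [hg]
    refine (hf _).sub_eq hW hcov (fun y => Filter.Eventually.of_forall fun z j hj => ?_) _ _
    rw [hg']
    exact hc i j (((incl (W i)).comp γ).comp (affineSimplex ![y, z])) (fun s => (γ _).2) hj

/-- A cocycle is determined by its restrictions to the members of an open cover. -/
theorem Cocycle.eq_of_comap_incl_eq (hW : ∀ i, IsOpen (W i)) (hcov : ∀ x, ∃ i, x ∈ W i)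
    {c c' : Cocycle X A} (h : ∀ i, c.comap (incl (W i)) = c'.comap (incl (W i))) : c = c' := by
  ext γ
  obtain ⟨g, hg, hg1⟩ := c.exists_primitive γ
  obtain ⟨g', hg', hg1'⟩ := c'.exists_primitive γ
  rw [hg, hg']
  refine IsPrimitive.sub_eq hW hcov (c := fun i => c.comap (incl (W i))) (h := γ)
    (fun y => Filter.Eventually.of_forall fun z i hi => ?_)
    (fun y => Filter.Eventually.of_forall fun z i hi => ?_) _ _
  · rw [hg1]; rfl
  · rw [hg1']
    exact congr_arg (fun c => c.toFun (restr (γ.comp (affineSimplex ![y, z])) hi)) (h i).symm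

end Glue

/-! ### The Mayer--Vietoris sequence in degree one -/

section MayerVietoris

variable {X : Type} [TopologicalSpace X] {A : Type} [AddCommGroup A] {U V : Set X}

/-- The two members of an open cover as a family. -/
def coverPair (U V : Set X) : Bool → Set X
  | true => U
  | false => V

/-- Two local cocycles as a family. -/
def cocyclePair (cU : Cocycle U A) (cV : Cocycle V A) : (b : Bool) → Cocycle (coverPair U V b) A
  | true => cU
  | false => cV

theorem isOpen_coverPair (hU : IsOpen U) (hV : IsOpen V) (b : Bool) : IsOpen (coverPair U V b) := by
  cases b
  exacts [hV, hU]

theorem exists_mem_coverPair {X : Type} {U V : Set X} (hUV : U ∪ V = univ) (x : X) :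
    ∃ b, x ∈ coverPair U V b := by
  rcases (hUV.symm ▸ mem_univ x : x ∈ U ∪ V) with h | h
  exacts [⟨true, h⟩, ⟨false, h⟩]

variable [Module ℤ A]

/-- Homomorphisms on the first homology of two open sets that agree on the intersection extend to
the union. -/
theorem exists_extension_of_cover (hU : IsOpen U) (hV : IsOpen V) (hUV : U ∪ V = univ)
    (a : H1 ℤ U →ₗ[ℤ] A) (b : H1 ℤ V →ₗ[ℤ] A)
    (hab : a ∘ₗ H1map ℤ (ContinuousMap.inclusion (inter_subset_left : U ∩ V ⊆ U)) =
      b ∘ₗ H1map ℤ (ContinuousMap.inclusion (inter_subset_right : U ∩ V ⊆ V))) :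
    ∃ φ : H1 ℤ X →ₗ[ℤ] A, φ ∘ₗ H1map ℤ (incl U) = a ∧ φ ∘ₗ H1map ℤ (incl V) = b := by
  obtain ⟨cU, rfl⟩ := exists_cocycle_eval_eq a
  obtain ⟨cV, rfl⟩ := exists_cocycle_eval_eq b
  rw [← Cocycle.eval_comap, ← Cocycle.eval_comap, ← sub_eq_zero, ← Cocycle.eval_sub] at hab
  obtain ⟨g, hg⟩ := Cocycle.exists_eq_coboundary _ hab
  -- Extending `g` by zero to `U` is harmless, since cochains need not be continuous.
  classical
  let g' : U → A := fun x => if h : (x : X) ∈ V then g ⟨x, x.2, h⟩ else 0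
  have key : ∀ (γ : C(Simplex 1, X)) (hγU : ∀ s, γ s ∈ U) (hγV : ∀ s, γ s ∈ V),
      (cU - Cocycle.coboundary g') (restr γ hγU) = cV (restr γ hγV) := by
    intro γ hγU hγV
    have h1 := congr_arg (fun c => c.toFun (restr γ fun s => ⟨hγU s, hγV s⟩)) hg
    have h2 : ∀ s, g' (restr γ hγU s) = g (restr γ (W := U ∩ V) (fun s => ⟨hγU s, hγV s⟩) s) :=
      fun s => dif_pos (hγV s)
    rw [Cocycle.sub_apply, Cocycle.coboundary_apply, h2, h2]
    change cU (restr γ hγU) - cV (restr γ hγV) = _ at h1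
    rw [sub_eq_iff_eq_add] at h1
    rw [h1]
    exact add_sub_cancel_left _ _
  obtain ⟨c, hc⟩ := exists_glue (isOpen_coverPair hU hV) (exists_mem_coverPair hUV)
    (c := cocyclePair (cU - Cocycle.coboundary g') cV) (by
      rintro (_ | _) (_ | _) γ hi hj
      · rfl
      · exact (key γ hj hi).symm
      · exact key γ hi hj
      · rfl)
  refine ⟨c.eval, ?_, ?_⟩
  · rw [← Cocycle.eval_comap, show c.comap (incl U) = _ from hc true]
    exact (Cocycle.eval_sub _ _).trans (by rw [Cocycle.eval_coboundary, sub_zero])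
  · rw [← Cocycle.eval_comap, show c.comap (incl V) = _ from hc false]
    rfl

/-- A homomorphism on the first homology of a union of two open sets with path-connected
intersection is zero if it is zero on both sets. -/
theorem eq_zero_of_cover (hU : IsOpen U) (hV : IsOpen V) (hUV : U ∪ V = univ)
    (hc : IsPathConnected (U ∩ V)) (φ : H1 ℤ X →ₗ[ℤ] A)
    (hφU : φ ∘ₗ H1map ℤ (incl U) = 0) (hφV : φ ∘ₗ H1map ℤ (incl V) = 0) : φ = 0 := by
  obtain ⟨c, rfl⟩ := exists_cocycle_eval_eq φ
  rw [← Cocycle.eval_comap] at hφU hφV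
  obtain ⟨gU, hgU⟩ := Cocycle.exists_eq_coboundary _ hφU
  obtain ⟨gV, hgV⟩ := Cocycle.exists_eq_coboundary _ hφV
  obtain ⟨p, hpU, hpV⟩ := hc.nonempty
  have hconst : ∀ x (hxU : x ∈ U) (hxV : x ∈ V),
      gU ⟨x, hxU⟩ - gU ⟨p, hpU⟩ = gV ⟨x, hxV⟩ - gV ⟨p, hpV⟩ := by
    intro x hxU hxV
    obtain ⟨q, hq⟩ := hc.joinedIn p ⟨hpU, hpV⟩ x ⟨hxU, hxV⟩
    have hγ : ∀ s, pathSimplex q s ∈ U ∩ V := fun s => hq _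
    have e1 := congr_arg (fun c => c.toFun (restr (pathSimplex q) fun s => (hγ s).1)) hgU
    have e2 := congr_arg (fun c => c.toFun (restr (pathSimplex q) fun s => (hγ s).2)) hgV
    have e : ∀ (W : Set X) (g : W → A) (h : ∀ s, pathSimplex q s ∈ W) (hx : x ∈ W) (hp : p ∈ W),
        Cocycle.coboundary g (restr (pathSimplex q) h) = g ⟨x, hx⟩ - g ⟨p, hp⟩ := by
      intro W g h hx hp
      have h1 : restr (pathSimplex q) h (vtx 1) = ⟨x, hx⟩ := Subtype.ext (pathSimplex_one q)
      have h0 : restr (pathSimplex q) h (vtx 0) = ⟨p, hp⟩ := Subtype.ext (pathSimplex_zero q)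
      rw [Cocycle.coboundary_apply, h1, h0]
    rw [e U gU _ hxU hpU] at e1
    rw [e V gV _ hxV hpV] at e2
    exact e1.symm.trans e2
  classical
  let g : X → A := fun x => if h : x ∈ U then gU ⟨x, h⟩ - gU ⟨p, hpU⟩ else
    if h : x ∈ V then gV ⟨x, h⟩ - gV ⟨p, hpV⟩ else 0
  have hgU' : ∀ x : U, g x = gU x - gU ⟨p, hpU⟩ := fun x => dif_pos x.2
  have hgV' : ∀ x : V, g x = gV x - gV ⟨p, hpV⟩ := fun x => by
    by_cases h : (x : X) ∈ U
    · exact (dif_pos h).trans (hconst _ _ _)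
    · exact (dif_neg h).trans (dif_pos x.2)
  have hcg : c = Cocycle.coboundary g := by
    refine Cocycle.eq_of_comap_incl_eq (isOpen_coverPair hU hV) (exists_mem_coverPair hUV) ?_
    rintro (_ | _)
    · refine Eq.trans hgV (Cocycle.ext fun γ => ?_)
      change gV _ - gV _ = g (γ (vtx 1)).1 - g (γ (vtx 0)).1
      rw [hgV' (γ (vtx 1)), hgV' (γ (vtx 0))]
      abel
    · refine Eq.trans hgU (Cocycle.ext fun γ => ?_)
      change gU _ - gU _ = g (γ (vtx 1)).1 - g (γ (vtx 0)).1
      rw [hgU' (γ (vtx 1)), hgU' (γ (vtx 0))]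
      abel
  rw [hcg, Cocycle.eval_coboundary]

end MayerVietoris

/-! ### Products, topological groups and the torus -/

section Product

variable {X Y Z : Type} [TopologicalSpace X] [TopologicalSpace Y] [TopologicalSpace Z]
variable {A : Type} [AddCommGroup A]

/-- The inclusion of a horizontal slice. -/
def sliceLeft (X : Type) [TopologicalSpace X] (y : Y) : C(X, X × Y) := ⟨fun x => (x, y), by fun_prop⟩

/-- The inclusion of a vertical slice. -/
def sliceRight (Y : Type) [TopologicalSpace Y] (x : X) : C(Y, X × Y) :=
  ⟨fun y => (x, y), by fun_prop⟩

/-- The value of a cocycle on the diagonal of a product of two paths can be computed along either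
pair of sides of the square. -/
theorem Cocycle.apply_prodMk (c : Cocycle (X × Y) A) (α : C(Simplex 1, X)) (β : C(Simplex 1, Y)) :
    c (α.prodMk β) = c (α.prodMk (ContinuousMap.const _ (β (vtx 0)))) +
        c ((ContinuousMap.const _ (α (vtx 1))).prodMk β) ∧
      c (α.prodMk β) = c ((ContinuousMap.const _ (α (vtx 0))).prodMk β) +
        c (α.prodMk (ContinuousMap.const _ (β (vtx 1)))) := by
  obtain ⟨g, hg⟩ := (c.comap (α.prodMap β)).exists_eq_coboundary_of_contractible
  have key : ∀ p q : C(Simplex 1, Simplex 1), c ((α.comp p).prodMk (β.comp q)) =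
      g (p (vtx 1), q (vtx 1)) - g (p (vtx 0), q (vtx 0)) := fun p q =>
    congr_arg (fun c' => c'.toFun (p.prodMk q)) hg
  have h0 := key (.id _) (.id _)
  have h1 := key (.id _) (.const _ (vtx 0))
  have h2 := key (.const _ (vtx 1)) (.id _)
  have h3 := key (.const _ (vtx 0)) (.id _)
  have h4 := key (.id _) (.const _ (vtx 1))
  constructor
  · refine h0.trans (Eq.trans ?_ (congr_arg₂ (· + ·) h1 h2).symm)
    simp
  · refine h0.trans (Eq.trans ?_ (congr_arg₂ (· + ·) h3 h4).symm)
    simp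

/-- A cocycle on a product that is a coboundary on one slice in each direction is a coboundary: a
primitive at `(x, y)` is its value on a horizontal path followed by a vertical path to `(x, y)`. -/
theorem Cocycle.eval_prod_eq_zero [Module ℤ A] [PathConnectedSpace X] [PathConnectedSpace Y]
    (c : Cocycle (X × Y) A) (x₀ : X) (y₀ : Y) (hX : (c.comap (sliceLeft X y₀)).eval = 0)
    (hY : (c.comap (sliceRight Y x₀)).eval = 0) : c.eval = 0 := by
  obtain ⟨a, ha⟩ := Cocycle.exists_eq_coboundary _ hX
  obtain ⟨e, he⟩ := Cocycle.exists_eq_coboundary _ hY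
  have ha' : ∀ α : C(Simplex 1, X), c (α.prodMk (ContinuousMap.const _ y₀)) =
      a (α (vtx 1)) - a (α (vtx 0)) := fun α => congr_arg (fun c' => c'.toFun α) ha
  have he' : ∀ β : C(Simplex 1, Y), c ((ContinuousMap.const _ x₀).prodMk β) =
      e (β (vtx 1)) - e (β (vtx 0)) := fun β => congr_arg (fun c' => c'.toFun β) he
  let p : X → C(Simplex 1, X) := fun x => pathSimplex (PathConnectedSpace.somePath x₀ x)
  let q : Y → C(Simplex 1, Y) := fun y => pathSimplex (PathConnectedSpace.somePath y₀ y)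
  have hp0 : ∀ x, p x (vtx 0) = x₀ := fun x => pathSimplex_zero _
  have hp1 : ∀ x, p x (vtx 1) = x := fun x => pathSimplex_one _
  have hq0 : ∀ y, q y (vtx 0) = y₀ := fun y => pathSimplex_zero _
  have hq1 : ∀ y, q y (vtx 1) = y := fun y => pathSimplex_one _
  suffices c = coboundary fun z : X × Y => c ((p z.1).prodMk (ContinuousMap.const _ y₀)) +
      c ((ContinuousMap.const _ z.1).prodMk (q z.2)) by
    rw [this, eval_coboundary]
  ext γ
  let α : C(Simplex 1, X) := ⟨fun s => (γ s).1, by fun_prop⟩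
  let β : C(Simplex 1, Y) := ⟨fun s => (γ s).2, by fun_prop⟩
  have hγ : γ = α.prodMk β := rfl
  have e0 := (c.apply_prodMk α β).2
  have e1 := c.apply_prodMk α (q (β (vtx 1)))
  have e2 := c.apply_prodMk (p (α (vtx 0))) β
  have e3 := c.apply_prodMk (p (α (vtx 0))) (q (β (vtx 0)))
  have e4 := c.apply_prodMk (p (α (vtx 0))) (q (β (vtx 1)))
  simp only [hp0, hp1, hq0, hq1, ha', he'] at e0 e1 e2 e3 e4
  have e5 := ha' (p (α (vtx 0)))
  have e6 := ha' (p (α (vtx 1)))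
  simp only [hp0, hp1] at e5 e6
  have g1 : (γ (vtx 1)).1 = α (vtx 1) := rfl
  have g2 : (γ (vtx 1)).2 = β (vtx 1) := rfl
  have g3 : (γ (vtx 0)).1 = α (vtx 0) := rfl
  have g4 : (γ (vtx 0)).2 = β (vtx 0) := rfl
  rw [coboundary_apply, g1, g2, g3, g4, e6, e5, hγ, e0]
  have f1 := e1.1.symm.trans e1.2
  have f2 := e2.1.symm.trans e2.2
  have f3 := e3.1.symm.trans e3.2
  have f4 := e4.1.symm.trans e4.2
  grind

/-- The Künneth formula in degree one: a class on a product of path-connected spaces is the sum of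
its projections to the two factors. -/
theorem H1_prod_eq [PathConnectedSpace X] [PathConnectedSpace Y] (x₀ : X) (y₀ : Y)
    (z : H1 ℤ (X × Y)) :
    z = H1map ℤ (sliceLeft X y₀) (H1map ℤ ContinuousMap.fst z) +
      H1map ℤ (sliceRight Y x₀) (H1map ℤ ContinuousMap.snd z) := by
  obtain ⟨c, hc⟩ := exists_cocycle_eval_eq (LinearMap.id : H1 ℤ (X × Y) →ₗ[ℤ] H1 ℤ (X × Y))
  let c' : Cocycle (X × Y) (H1 ℤ (X × Y)) := c - c.comap ((sliceLeft X y₀).comp .fst) -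
    c.comap ((sliceRight Y x₀).comp .snd)
  have hc' : c'.eval = 0 := by
    refine c'.eval_prod_eq_zero x₀ y₀ ?_ ?_
    · rw [Cocycle.eval_comap, Cocycle.eval_sub, Cocycle.eval_sub, Cocycle.eval_comap,
        Cocycle.eval_comap, hc, LinearMap.sub_comp, LinearMap.sub_comp, LinearMap.id_comp,
        LinearMap.id_comp, LinearMap.id_comp, ← H1map_comp, ← H1map_comp]
      have h1 : ((sliceLeft X y₀).comp .fst).comp (sliceLeft X y₀) = sliceLeft X y₀ := rfl
      have h2 : ((sliceRight Y x₀).comp .snd).comp (sliceLeft X y₀) = .const X (x₀, y₀) := rfl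
      rw [h1, h2, H1map_const]
      simp
    · rw [Cocycle.eval_comap, Cocycle.eval_sub, Cocycle.eval_sub, Cocycle.eval_comap,
        Cocycle.eval_comap, hc, LinearMap.sub_comp, LinearMap.sub_comp, LinearMap.id_comp,
        LinearMap.id_comp, LinearMap.id_comp, ← H1map_comp, ← H1map_comp]
      have h1 : ((sliceLeft X y₀).comp .fst).comp (sliceRight Y x₀) = .const Y (x₀, y₀) := rfl
      have h2 : ((sliceRight Y x₀).comp .snd).comp (sliceRight Y x₀) = sliceRight Y x₀ := rfl
      rw [h1, h2, H1map_const]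
      simp
  have h := DFunLike.congr_fun hc' z
  rw [Cocycle.eval_sub, Cocycle.eval_sub, Cocycle.eval_comap, Cocycle.eval_comap, hc,
    H1map_comp, H1map_comp] at h
  simp only [LinearMap.sub_apply, LinearMap.comp_apply, LinearMap.id_apply, LinearMap.zero_apply]
    at h
  rwa [sub_sub, sub_eq_zero] at h

/-- On the first homology, a pointwise product of maps to a topological group induces the sum. -/
theorem H1map_mul {G : Type} [TopologicalSpace G] [Group G] [IsTopologicalGroup G]
    [PathConnectedSpace G] (f g : C(Z, G)) : H1map ℤ (f * g) = H1map ℤ f + H1map ℤ g := by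
  ext z
  let m : C(G × G, G) := ⟨fun p => p.1 * p.2, by fun_prop⟩
  have h1 : f * g = m.comp (f.prodMk g) := rfl
  have h2 : m.comp (sliceLeft G 1) = .id G := by ext x; exact mul_one x
  have h3 : m.comp (sliceRight G 1) = .id G := by ext x; exact one_mul x
  have h4 : ContinuousMap.fst.comp (f.prodMk g) = f := rfl
  have h5 : ContinuousMap.snd.comp (f.prodMk g) = g := rfl
  rw [h1, H1map_comp, LinearMap.comp_apply, H1_prod_eq 1 1 (H1map ℤ (f.prodMk g) z), map_add,
    ← LinearMap.comp_apply, ← LinearMap.comp_apply (H1map ℤ m), ← H1map_comp, ← H1map_comp, h2, h3,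
    H1map_id, ← LinearMap.comp_apply (H1map ℤ ContinuousMap.fst), ← H1map_comp, h4,
    ← LinearMap.comp_apply (H1map ℤ ContinuousMap.snd), ← H1map_comp, h5]
  rfl

theorem H1map_inv {G : Type} [TopologicalSpace G] [Group G] [IsTopologicalGroup G]
    [PathConnectedSpace G] (f : C(Z, G)) : H1map ℤ f⁻¹ = -H1map ℤ f := by
  have h : f⁻¹ * f = .const Z 1 := by ext z; exact inv_mul_cancel _
  rw [eq_neg_iff_add_eq_zero, ← H1map_mul, h, H1map_const]

end Product

section CircleHomology

/-- The path from `i` to `-i` on the unit circle, along the right (`σ = -1`) or left (`σ = 1`)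
half. -/
def halfCircle (σ : ℝ) : C(Simplex 1, Circle) :=
  ⟨fun s => Circle.exp (Real.pi / 2 + σ * (Real.pi * s.1 1)), by
    have : Continuous fun s : Simplex 1 => s.1 1 := (continuous_apply 1).comp continuous_subtype_val
    exact Circle.exp.continuous.comp
      (continuous_const.add (continuous_const.mul (continuous_const.mul this)))⟩

/-- The cocycle on the circle that counts crossings of the point `-1`.  It is glued from zero on the
complement of `-1` and the coboundary of the indicator of the upper half circle on the complement
of `1`.  It is not a coboundary. -/
theorem exists_circle_cocycle : ∃ c : Cocycle Circle ℤ, c.eval ≠ 0 := by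
  classical
  let U : Set Circle := {z | z ≠ 1}
  let V : Set Circle := {z | z ≠ -1}
  let g : Circle → ℤ := fun z => if 0 < (z : ℂ).im then 1 else 0
  have him : ∀ z : Circle, z ≠ 1 → z ≠ -1 → (z : ℂ).im ≠ 0 := by
    intro z h1 h2 h0
    have hn := Circle.normSq_coe z
    rw [Complex.normSq_apply, h0] at hn
    have : ((z : ℂ).re - 1) * ((z : ℂ).re + 1) = 0 := by linarith
    rcases mul_eq_zero.1 this with h | h
    · exact h1 (Circle.ext (Complex.ext (by simp; linarith) (by simpa using h0)))
    · exact h2 (Circle.ext (Complex.ext (by simp; linarith) (by simpa using h0)))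
  have hcompat : ∀ (γ : C(Simplex 1, Circle)) (hU : ∀ s, γ s ∈ U) (_ : ∀ s, γ s ∈ V),
      Cocycle.coboundary (fun z : U => g z) (restr γ hU) = 0 := by
    intro γ hU hV
    have hl : IsLocallyConstant fun s => g (γ s) := by
      rw [IsLocallyConstant.iff_eventually_eq]
      intro s
      have hcont : Continuous fun s => (γ s : ℂ).im := by fun_prop
      rcases lt_or_gt_of_ne (him _ (hU s) (hV s)) with h | h
      · filter_upwards [hcont.continuousAt.eventually (gt_mem_nhds h)] with t ht
        simp only [g, if_neg h.not_gt, if_neg (not_lt_of_gt ht)]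
      · filter_upwards [hcont.continuousAt.eventually (lt_mem_nhds h)] with t ht
        simp only [g, if_pos h, if_pos ht]
    exact sub_eq_zero.2 (hl.apply_eq_of_preconnectedSpace (vtx 1) (vtx 0))
  have hne : (1 : Circle) ≠ -1 := fun h => by
    have := congr_arg (fun z : Circle => (z : ℂ).re) h
    norm_num at this
  have hUV : U ∪ V = univ := by
    refine eq_univ_of_forall fun z => ?_
    by_cases h : z = 1
    · exact Or.inr (h ▸ hne)
    · exact Or.inl h
  obtain ⟨c, hc⟩ := exists_glue (isOpen_coverPair isOpen_ne isOpen_ne) (exists_mem_coverPair hUV)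
    (c := cocyclePair (Cocycle.coboundary fun z : U => g z) (0 : Cocycle V ℤ)) (by
      rintro (_ | _) (_ | _) γ hi hj
      · rfl
      · exact (hcompat γ hj hi).symm
      · exact hcompat γ hi hj
      · rfl)
  refine ⟨c, fun h0 => ?_⟩
  obtain ⟨f, hf⟩ := c.exists_eq_coboundary h0
  have hs0 : ∀ σ, halfCircle σ (vtx 0) = Circle.exp (Real.pi / 2) := by
    intro σ
    simp [halfCircle]
  have hs1 : ∀ σ, halfCircle σ (vtx 1) = Circle.exp (Real.pi / 2 + σ * Real.pi) := by
    intro σ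
    simp [halfCircle]
  have hre : ∀ σ s, (halfCircle σ s : ℂ).re = -Real.sin (σ * (Real.pi * s.1 1)) := by
    intro σ s
    change (Circle.exp (Real.pi / 2 + σ * (Real.pi * s.1 1)) : ℂ).re = _
    rw [Circle.coe_exp, Complex.exp_ofReal_mul_I_re, add_comm, Real.cos_add_pi_div_two]
  have hsin : ∀ s : Simplex 1, 0 ≤ Real.sin (Real.pi * s.1 1) := fun s =>
    Real.sin_nonneg_of_nonneg_of_le_pi (mul_nonneg Real.pi_pos.le (stdSimplex.zero_le s 1))
      (mul_le_of_le_one_right Real.pi_pos.le (stdSimplex.le_one s 1))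
  have hmU : ∀ s, halfCircle 1 s ∈ U := fun s h => by
    have h1 := hre 1 s
    rw [h, one_mul, Circle.coe_one, Complex.one_re] at h1
    linarith [hsin s]
  have hmV : ∀ s, halfCircle (-1) s ∈ V := fun s h => by
    have h1 := hre (-1) s
    rw [h, neg_one_mul, Real.sin_neg] at h1
    have h2 : ((-1 : Circle) : ℂ).re = -1 := by simp
    linarith [hsin s]
  have e1 := congr_arg (fun c' => c'.toFun (restr (halfCircle 1) hmU)) (hc true)
  have e2 := congr_arg (fun c' => c'.toFun (restr (halfCircle (-1)) hmV)) (hc false)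
  change c (halfCircle 1) = g (halfCircle 1 (vtx 1)) - g (halfCircle 1 (vtx 0)) at e1
  change c (halfCircle (-1)) = 0 at e2
  rw [hf, Cocycle.coboundary_apply, hs0, hs1] at e1 e2
  have hend : Circle.exp (Real.pi / 2 + 1 * Real.pi) = Circle.exp (Real.pi / 2 + -1 * Real.pi) := by
    have := Circle.exp_add_two_pi (Real.pi / 2 + -1 * Real.pi)
    rw [← this]
    congr 1
    ring
  rw [← hend] at e2
  rw [e2] at e1
  have i0 : (Circle.exp (Real.pi / 2) : ℂ).im = 1 := by
    rw [Circle.coe_exp, Complex.exp_ofReal_mul_I_im, Real.sin_pi_div_two]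
  have i1 : (Circle.exp (Real.pi / 2 + 1 * Real.pi) : ℂ).im = -1 := by
    rw [Circle.coe_exp, Complex.exp_ofReal_mul_I_im, one_mul, Real.sin_add_pi,
      Real.sin_pi_div_two]
  simp only [g, i0, i1] at e1
  norm_num at e1

theorem exists_eq_zsmul_of_span {M : Type} [AddCommGroup M] [hM : Module ℤ M] {u : M}
    (hu : Submodule.span ℤ {u} = ⊤) (z : M) : ∃ n : ℤ, z = n • u := by
  obtain ⟨n, hn⟩ := Submodule.mem_span_singleton.1 (hu ▸ Submodule.mem_top : z ∈ Submodule.span ℤ {u})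
  exact ⟨n, hn.symm.trans (int_smul_eq_zsmul hM n u)⟩

/-- A generator of the first homology group of the circle is not a torsion element. -/
theorem eq_zero_of_smul_generator {u : H1 ℤ Circle} (hu : Submodule.span ℤ {u} = ⊤) {n : ℤ}
    (hn : n • u = 0) : n = 0 := by
  obtain ⟨c, hc⟩ := exists_circle_cocycle
  have h0 : c.eval u ≠ 0 := fun h0 => hc (by
    ext z
    obtain ⟨m, rfl⟩ := exists_eq_zsmul_of_span hu z
    rw [map_zsmul, h0, zsmul_zero, LinearMap.zero_apply])
  have h1 := congr_arg c.eval hn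
  rw [map_zsmul, map_zero, smul_eq_mul] at h1
  exact (mul_eq_zero.1 h1).resolve_right h0

/-- The classes of the coordinate circles generate the first homology group of the torus. -/
theorem exists_torus_repr {u : H1 ℤ Circle} (hu : Submodule.span ℤ {u} = ⊤) (z : H1 ℤ Torus) :
    ∃ m n : ℤ, z = m • H1map ℤ (sliceLeft Circle (1 : Circle)) u +
      n • H1map ℤ (sliceRight Circle (1 : Circle)) u := by
  have h := H1_prod_eq (1 : Circle) (1 : Circle) z
  obtain ⟨m, hm⟩ := exists_eq_zsmul_of_span hu (H1map ℤ ContinuousMap.fst z)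
  obtain ⟨n, hn⟩ := exists_eq_zsmul_of_span hu (H1map ℤ ContinuousMap.snd z)
  refine ⟨m, n, ?_⟩
  rw [hm, hn, map_zsmul, map_zsmul] at h
  exact h

/-- The classes of the coordinate circles in the first homology group of the torus are
independent. -/
theorem torus_repr_eq_zero {u : H1 ℤ Circle} (hu : Submodule.span ℤ {u} = ⊤) {m n : ℤ}
    (h : m • H1map ℤ (sliceLeft Circle (1 : Circle)) u +
      n • H1map ℤ (sliceRight Circle (1 : Circle)) u = 0) : m = 0 ∧ n = 0 := by
  have h1 : (ContinuousMap.fst : C(Torus, Circle)).comp (sliceLeft Circle (1 : Circle)) = .id _ :=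
    rfl
  have h2 : (ContinuousMap.fst : C(Torus, Circle)).comp (sliceRight Circle (1 : Circle)) =
    .const _ 1 := rfl
  have h3 : (ContinuousMap.snd : C(Torus, Circle)).comp (sliceLeft Circle (1 : Circle)) =
    .const _ 1 := rfl
  have h4 : (ContinuousMap.snd : C(Torus, Circle)).comp (sliceRight Circle (1 : Circle)) = .id _ :=
    rfl
  constructor
  · have h0 := congr_arg (H1map ℤ (ContinuousMap.fst : C(Torus, Circle))) h
    rw [map_add, map_zsmul, map_zsmul, ← LinearMap.comp_apply, ← LinearMap.comp_apply, ← H1map_comp,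
      ← H1map_comp, h1, h2, H1map_id, H1map_const, LinearMap.zero_apply, zsmul_zero, add_zero,
      map_zero, LinearMap.id_apply] at h0
    exact eq_zero_of_smul_generator hu h0
  · have h0 := congr_arg (H1map ℤ (ContinuousMap.snd : C(Torus, Circle))) h
    rw [map_add, map_zsmul, map_zsmul, ← LinearMap.comp_apply, ← LinearMap.comp_apply, ← H1map_comp,
      ← H1map_comp, h3, h4, H1map_id, H1map_const, LinearMap.zero_apply, zsmul_zero, zero_add,
      map_zero, LinearMap.id_apply] at h0
    exact eq_zero_of_smul_generator hu h0

end CircleHomology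

/-! ### Dehn fillings -/

/-- The closed unit disc. -/
abbrev Disc : Type := closedBall (0 : ℂ) 1

/-- The radial retraction of the plane onto the closed unit disc. -/
def clampDisc : C(ℂ, Disc) where
  toFun v := ⟨(max 1 ‖v‖)⁻¹ • v, by
    have h : 0 < max 1 ‖v‖ := lt_max_of_lt_left one_pos
    rw [mem_closedBall_zero_iff, norm_smul, norm_inv, Real.norm_of_nonneg h.le,
      inv_mul_le_iff₀ h, mul_one]
    exact le_max_right _ _⟩
  continuous_toFun := by
    have h : Continuous fun v : ℂ => max 1 ‖v‖ := by fun_prop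
    exact ((h.inv₀ fun v => (lt_max_of_lt_left one_pos).ne').smul continuous_id).subtype_mk _

theorem clampDisc_coe {v : ℂ} (hv : ‖v‖ ≤ 1) : (clampDisc v : ℂ) = v := by
  change (max 1 ‖v‖)⁻¹ • v = v
  rw [max_eq_left hv, inv_one, one_smul]

theorem clampDisc_self (v : Disc) : clampDisc v = v :=
  Subtype.ext (clampDisc_coe (mem_closedBall_zero_iff.1 v.2))

theorem norm_disc_le (v : Disc) : ‖(v : ℂ)‖ ≤ 1 := mem_closedBall_zero_iff.1 v.2

/-- The boundary circle of the disc. -/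
def discBoundary : C(Circle, Disc) :=
  have h : ∀ w : Circle, (w : ℂ) ∈ closedBall (0 : ℂ) 1 := fun w => by
    rw [mem_closedBall_zero_iff, Circle.norm_coe]
  ⟨fun w => ⟨(w : ℂ), h w⟩, Continuous.subtype_mk (by fun_prop) h⟩

theorem discBoundary_coe (w : Circle) : (discBoundary w : ℂ) = w := rfl

theorem norm_discBoundary (w : Circle) : ‖(discBoundary w : ℂ)‖ = 1 := by
  rw [discBoundary_coe, Circle.norm_coe]

/-- The point of the unit circle in the direction of a nonzero complex number. -/
def direction (v : ℂ) (hv : v ≠ 0) : Circle :=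
  ⟨(‖v‖⁻¹ : ℝ) • v, by
    have h : ‖v‖ ≠ 0 := norm_ne_zero_iff.2 hv
    rw [Submonoid.unitSphere, ← SetLike.mem_coe]
    change _ ∈ sphere (0 : ℂ) 1
    rw [mem_sphere_zero_iff_norm, norm_smul, norm_inv, norm_norm, inv_mul_cancel₀ h]⟩

theorem direction_coe (v : ℂ) (hv : v ≠ 0) : (direction v hv : ℂ) = (‖v‖⁻¹ : ℝ) • v := rfl

theorem continuous_direction {Y : Type} [TopologicalSpace Y] {f : Y → ℂ} (hf : Continuous f)
    (h0 : ∀ y, f y ≠ 0) : Continuous fun y => direction (f y) (h0 y) :=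
  Continuous.subtype_mk ((hf.norm.inv₀ fun y => norm_ne_zero_iff.2 (h0 y)).smul hf) _

/-- The space `X` is the union of the closed subset `P` and of a solid torus, embedded by `e`, that
meets `P` exactly in its boundary torus. -/
structure IsDehnFilling {X : Type} [TopologicalSpace X] (P : Set X) (e : C(Circle × Disc, X)) :
    Prop where
  isClosed : IsClosed P
  injective : Function.Injective e
  cover : ∀ x, x ∈ P ∨ x ∈ range e
  mem_iff : ∀ q, e q ∈ P ↔ ‖(q.2 : ℂ)‖ = 1

/-- The radial isotopy of the solid torus that pushes the points at distance at least `1/2` from the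
core circle to the boundary, at time `τ`. -/
def stretch (τ : ℝ) (q : Circle × Disc) : Circle × Disc :=
  (q.1, clampDisc (((1 - τ) + τ / max ‖(q.2 : ℂ)‖ (1 / 2)) • (q.2 : ℂ)))

theorem continuous_stretch : Continuous fun p : ℝ × (Circle × Disc) => stretch p.1 p.2 := by
  unfold stretch
  have h : Continuous fun p : ℝ × (Circle × Disc) => p.1 / max ‖(p.2.2 : ℂ)‖ (1 / 2) :=
    Continuous.div (by fun_prop) (by fun_prop)
      fun p => (lt_max_of_lt_right (by norm_num : (0 : ℝ) < 1 / 2)).ne'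
  fun_prop

theorem stretch_coe {τ : ℝ} (h0 : 0 ≤ τ) (h1 : τ ≤ 1) {q : Circle × Disc}
    (hq : 1 / 2 ≤ ‖(q.2 : ℂ)‖) :
    ((stretch τ q).2 : ℂ) = ((1 - τ) + τ / ‖(q.2 : ℂ)‖) • (q.2 : ℂ) ∧
      ‖((stretch τ q).2 : ℂ)‖ = (1 - τ) * ‖(q.2 : ℂ)‖ + τ := by
  have hpos : 0 < ‖(q.2 : ℂ)‖ := by linarith
  have hn : ‖((1 - τ) + τ / ‖(q.2 : ℂ)‖) • (q.2 : ℂ)‖ = (1 - τ) * ‖(q.2 : ℂ)‖ + τ := by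
    rw [norm_smul, Real.norm_of_nonneg (add_nonneg (sub_nonneg.2 h1) (div_nonneg h0 hpos.le))]
    field_simp
  have h : ((stretch τ q).2 : ℂ) = ((1 - τ) + τ / ‖(q.2 : ℂ)‖) • (q.2 : ℂ) := by
    change (clampDisc _ : ℂ) = _
    rw [max_eq_left hq]
    refine clampDisc_coe ?_
    rw [hn]
    nlinarith [norm_disc_le q.2]
  exact ⟨h, h ▸ hn⟩

theorem stretch_zero (q : Circle × Disc) : stretch 0 q = q := by
  refine Prod.ext rfl ?_
  change clampDisc _ = _
  rw [sub_zero, zero_div, add_zero, one_smul, clampDisc_self]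

theorem stretch_of_norm_eq_one (τ : ℝ) {q : Circle × Disc} (hq : ‖(q.2 : ℂ)‖ = 1) :
    stretch τ q = q := by
  refine Prod.ext rfl ?_
  change clampDisc _ = _
  rw [hq, max_eq_left (by norm_num), div_one, sub_add_cancel, one_smul, clampDisc_self]

/-- A map is continuous if its restrictions to the members of a cover by a closed set and by the
image of a closed embedding are. -/
theorem continuous_of_closed_cover {X Y K : Type} [TopologicalSpace X] [TopologicalSpace Y]
    [TopologicalSpace K] {P : Set X} (hP : IsClosed P) {e : K → X}
    (he : Topology.IsClosedEmbedding e) (hcov : ∀ x, x ∈ P ∨ x ∈ range e) {F : X → Y}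
    (hFP : ContinuousOn F P) (hFe : Continuous (F ∘ e)) : Continuous F := by
  refine continuous_iff_isClosed.2 fun C hC => ?_
  have h : F ⁻¹' C = (P ∩ F ⁻¹' C) ∪ e '' ((F ∘ e) ⁻¹' C) := by
    ext x
    constructor
    · intro hx
      rcases hcov x with h | ⟨q, rfl⟩
      exacts [Or.inl ⟨h, hx⟩, Or.inr ⟨q, hx, rfl⟩]
    · rintro (h | ⟨q, hq, rfl⟩)
      exacts [h.2, hq]
  rw [h]
  exact (hFP.preimage_isClosed_of_isClosed hP hC).union
    (he.isClosedMap _ (hC.preimage hFe))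

namespace IsDehnFilling

variable {X : Type} [TopologicalSpace X] {P : Set X} {e : C(Circle × Disc, X)}
  (h : IsDehnFilling P e)

open Classical in
/-- The deformation of `X` that fixes `P` and stretches the solid torus. -/
def deform (_ : IsDehnFilling P e) (p : ℝ × X) : X :=
  if hx : ∃ q, e q = p.2 then e (stretch p.1 hx.choose) else p.2

theorem deform_apply (τ : ℝ) (q : Circle × Disc) : h.deform (τ, e q) = e (stretch τ q) := by
  have hx : ∃ q', e q' = e q := ⟨q, rfl⟩
  have : hx.choose = q := h.injective hx.choose_spec
  exact (dif_pos hx).trans (by rw [this])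

theorem deform_of_mem (τ : ℝ) {x : X} (hx : x ∈ P) : h.deform (τ, x) = x := by
  by_cases hq : ∃ q, e q = x
  · obtain ⟨q, rfl⟩ := hq
    rw [deform_apply, stretch_of_norm_eq_one τ ((h.mem_iff q).1 hx)]
  · exact dif_neg hq

/-- The complement of the closed solid torus of half the radius. -/
def outer (_ : IsDehnFilling P e) : Set X := (e '' {q | ‖(q.2 : ℂ)‖ ≤ 1 / 2})ᶜ

theorem mem_outer_iff (q : Circle × Disc) : e q ∈ h.outer ↔ 1 / 2 < ‖(q.2 : ℂ)‖ := by
  rw [outer, mem_compl_iff, h.injective.mem_set_image, mem_ofPred_eq, not_le]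

theorem subset_outer : P ⊆ h.outer := by
  intro x hx
  by_contra hn
  obtain ⟨q, hq, rfl⟩ := not_not.1 hn
  have := (h.mem_iff q).1 hx
  rw [mem_ofPred_eq, this] at hq
  norm_num at hq

theorem outer_union_compl : h.outer ∪ Pᶜ = univ :=
  eq_univ_of_forall fun x => by
    by_cases hx : x ∈ P
    exacts [Or.inl (h.subset_outer hx), Or.inr hx]

theorem deform_mem_outer {τ : ℝ} (h0 : 0 ≤ τ) (h1 : τ ≤ 1) {x : X} (hx : x ∈ h.outer) :
    h.deform (τ, x) ∈ h.outer := by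
  rcases h.cover x with hP | ⟨q, rfl⟩
  · rwa [h.deform_of_mem τ hP]
  · rw [mem_outer_iff] at hx
    rw [deform_apply, mem_outer_iff, (stretch_coe h0 h1 hx.le).2]
    nlinarith [norm_disc_le q.2]

theorem deform_one_mem {x : X} (hx : x ∈ h.outer) : h.deform (1, x) ∈ P := by
  rcases h.cover x with hP | ⟨q, rfl⟩
  · rwa [h.deform_of_mem 1 hP]
  · rw [mem_outer_iff] at hx
    rw [deform_apply, h.mem_iff, (stretch_coe zero_le_one le_rfl hx.le).2]
    norm_num

theorem mem_compl_of_norm_lt (h : IsDehnFilling P e) {q : Circle × Disc} (hq : ‖(q.2 : ℂ)‖ < 1) :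
    e q ∈ Pᶜ :=
  fun h1 => hq.ne ((h.mem_iff q).1 h1)

variable [T2Space X]

theorem isClosedEmbedding (h : IsDehnFilling P e) : Topology.IsClosedEmbedding e :=
  e.continuous.isClosedEmbedding h.injective

theorem continuous_deform : Continuous h.deform := by
  have he : Topology.IsClosedEmbedding (Prod.map id e : ℝ × (Circle × Disc) → ℝ × X) :=
    Topology.IsClosedEmbedding.id.prodMap h.isClosedEmbedding
  refine continuous_of_closed_cover (h.isClosed.preimage continuous_snd) he (fun x => ?_) ?_ ?_
  · rcases h.cover x.2 with hx | ⟨q, hq⟩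
    exacts [Or.inl hx, Or.inr ⟨(x.1, q), Prod.ext rfl hq⟩]
  · exact continuous_snd.continuousOn.congr fun p hp => h.deform_of_mem p.1 hp
  · have : h.deform ∘ (Prod.map id e) = fun p : ℝ × (Circle × Disc) => e (stretch p.1 p.2) :=
      funext fun p => h.deform_apply p.1 p.2
    rw [this]
    exact e.continuous.comp continuous_stretch

theorem isOpen_outer : IsOpen h.outer :=
  (h.isClosedEmbedding.isClosedMap _ (isClosed_le (by fun_prop) continuous_const)).isOpen_compl

/-- The retraction of the complement of the smaller solid torus onto `P`. -/
def retract : C(h.outer, P) :=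
  ⟨fun x => ⟨h.deform (1, x), h.deform_one_mem x.2⟩,
    (h.continuous_deform.comp (by fun_prop)).subtype_mk _⟩

/-- The inclusion of `P` in the complement of the smaller solid torus. -/
def inclOuter : C(P, h.outer) := ContinuousMap.inclusion h.subset_outer

theorem retract_comp_inclOuter : h.retract.comp h.inclOuter = .id P := by
  ext x
  exact h.deform_of_mem 1 x.2

theorem inclOuter_comp_retract : (h.inclOuter.comp h.retract).Homotopic (.id h.outer) := by
  refine ContinuousMap.Homotopic.symm ⟨⟨⟨fun p => ⟨h.deform (p.1, p.2),
    h.deform_mem_outer p.1.2.1 p.1.2.2 p.2.2⟩, ?_⟩, fun x => ?_, fun x => ?_⟩⟩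
  · exact (h.continuous_deform.comp (by fun_prop)).subtype_mk _
  · refine Subtype.ext ?_
    change h.deform ((0 : ℝ), (x : X)) = x
    rcases h.cover x with hP | ⟨q, hq⟩
    · exact h.deform_of_mem 0 hP
    · rw [← hq, deform_apply, stretch_zero]
  · rfl

/-- The coordinates of a point of the open solid torus. -/
def coord : C((Pᶜ : Set X), Circle × Disc) :=
  ⟨fun x => h.isClosedEmbedding.isEmbedding.toHomeomorph.symm ⟨x, (h.cover x).resolve_left x.2⟩,
    (Homeomorph.continuous _).comp (continuous_subtype_val.subtype_mk _)⟩

theorem apply_coord (x : (Pᶜ : Set X)) : e (h.coord x) = x :=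
  congr_arg Subtype.val (h.isClosedEmbedding.isEmbedding.toHomeomorph.apply_symm_apply
    ⟨x, (h.cover x).resolve_left x.2⟩)

theorem norm_coord_lt (x : (Pᶜ : Set X)) : ‖((h.coord x).2 : ℂ)‖ < 1 :=
  lt_of_le_of_ne (norm_disc_le _) fun h1 => x.2 (h.apply_coord x ▸ (h.mem_iff _).2 h1)

theorem coord_apply {q : Circle × Disc} (hq : e q ∈ Pᶜ) : h.coord ⟨e q, hq⟩ = q :=
  h.injective (h.apply_coord _)

/-- The centre of the disc. -/
def discZero : Disc := ⟨0, mem_closedBall_self zero_le_one⟩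

/-- The core circle of the solid torus. -/
def core : C(Circle, (Pᶜ : Set X)) :=
  ⟨fun w => ⟨e (w, discZero), h.mem_compl_of_norm_lt (by simp [discZero])⟩,
    (e.continuous.comp (by fun_prop)).subtype_mk _⟩

/-- The projection of the open solid torus to its core circle. -/
def toCore : C((Pᶜ : Set X), Circle) := ContinuousMap.fst.comp h.coord

theorem core_comp_toCore : (h.core.comp h.toCore).Homotopic (.id _) := by
  have hn : ∀ (τ : ℝ) (_ : 0 ≤ τ) (_ : τ ≤ 1) (x : (Pᶜ : Set X)), ‖τ • ((h.coord x).2 : ℂ)‖ < 1 := by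
    intro τ h0 h1 x
    rw [norm_smul, Real.norm_of_nonneg h0]
    exact (mul_le_of_le_one_left (norm_nonneg _) h1).trans_lt (h.norm_coord_lt x)
  have hmem : ∀ p : unitInterval × (Pᶜ : Set X),
      e ((h.coord p.2).1, clampDisc ((p.1 : ℝ) • ((h.coord p.2).2 : ℂ))) ∈ Pᶜ := fun p => by
    have := hn p.1 p.1.2.1 p.1.2.2 p.2
    exact h.mem_compl_of_norm_lt (by rwa [clampDisc_coe this.le])
  refine ⟨⟨⟨fun p => ⟨_, hmem p⟩, ?_⟩, fun x => ?_, fun x => ?_⟩⟩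
  · exact (e.continuous.comp (by fun_prop)).subtype_mk _
  · refine Subtype.ext (congr_arg e (Prod.ext rfl ?_))
    refine Subtype.ext ((clampDisc_coe ?_).trans ?_) <;> simp [discZero]
  · refine Subtype.ext (Eq.trans (congr_arg e ?_) (h.apply_coord x))
    refine Prod.ext rfl ?_
    change clampDisc ((1 : ℝ) • ((h.coord x).2 : ℂ)) = _
    rw [one_smul, clampDisc_self]

/-- The torus at distance `3/4` from the core circle. -/
def middle : C(Torus, ↥(h.outer ∩ Pᶜ)) := by
  have hn : ∀ v : Circle, ‖(3 / 4 : ℝ) • (v : ℂ)‖ = 3 / 4 := fun v => by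
    rw [norm_smul, Circle.norm_coe, mul_one]; norm_num
  have hc : ∀ v : Circle, (clampDisc ((3 / 4 : ℝ) • (v : ℂ)) : ℂ) = (3 / 4 : ℝ) • (v : ℂ) :=
    fun v => clampDisc_coe (by rw [hn]; norm_num)
  exact ⟨fun g => ⟨e (g.1, clampDisc ((3 / 4 : ℝ) • (g.2 : ℂ))),
    (h.mem_outer_iff _).2 (by rw [hc, hn]; norm_num),
    h.mem_compl_of_norm_lt (by rw [hc, hn]; norm_num)⟩,
    (e.continuous.comp (by fun_prop)).subtype_mk _⟩

theorem coord_of_inter (x : ↥(h.outer ∩ Pᶜ)) :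
    1 / 2 < ‖((h.coord ⟨x, x.2.2⟩).2 : ℂ)‖ := by
  rw [← h.mem_outer_iff, h.apply_coord]
  exact x.2.1

/-- The angular coordinates on the open shell between two solid tori. -/
def toTorus : C(↥(h.outer ∩ Pᶜ), Torus) :=
  have h0 : ∀ x : ↥(h.outer ∩ Pᶜ), ((h.coord ⟨x, x.2.2⟩).2 : ℂ) ≠ 0 := fun x =>
    norm_pos_iff.1 ((by norm_num : (0 : ℝ) < 1 / 2).trans (h.coord_of_inter x))
  ⟨fun x => ((h.coord ⟨x, x.2.2⟩).1, direction ((h.coord ⟨x, x.2.2⟩).2 : ℂ) (h0 x)),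
    (by fun_prop : Continuous fun x : ↥(h.outer ∩ Pᶜ) => (h.coord ⟨x, x.2.2⟩).1).prodMk
      (continuous_direction (by fun_prop) h0)⟩

theorem middle_comp_toTorus : (h.middle.comp h.toTorus).Homotopic (.id _) := by
  let v : ↥(h.outer ∩ Pᶜ) → ℂ := fun x => (h.coord ⟨x, x.2.2⟩).2
  have hv : Continuous v := by fun_prop
  have hv1 : ∀ x, 1 / 2 < ‖v x‖ := h.coord_of_inter
  have hv2 : ∀ x, ‖v x‖ < 1 := fun x => h.norm_coord_lt _
  let f : unitInterval × ↥(h.outer ∩ Pᶜ) → ℂ := fun p =>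
    ((p.1 : ℝ) + (1 - p.1) * (3 / 4) * ‖v p.2‖⁻¹) • v p.2
  have hf : Continuous f := by
    have : Continuous fun p : unitInterval × ↥(h.outer ∩ Pᶜ) => ‖v p.2‖⁻¹ :=
      (by fun_prop : Continuous fun p : unitInterval × ↥(h.outer ∩ Pᶜ) => ‖v p.2‖).inv₀ fun p =>
        (lt_trans (by norm_num) (hv1 p.2)).ne'
    fun_prop
  have hn : ∀ p, ‖f p‖ = p.1 * ‖v p.2‖ + (1 - p.1) * (3 / 4) := fun p => by
    have hpos : 0 < ‖v p.2‖ := lt_trans (by norm_num) (hv1 p.2)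
    have h0 : (0 : ℝ) ≤ 1 - p.1 := sub_nonneg.2 p.1.2.2
    have h1 : (0 : ℝ) ≤ p.1 := p.1.2.1
    rw [norm_smul, Real.norm_of_nonneg (by positivity)]
    field_simp
  have hn01 : ∀ p, ‖f p‖ ∈ Ioo (1 / 2 : ℝ) 1 := fun p => by
    rw [hn]
    exact convex_Ioo (1 / 2 : ℝ) 1 ⟨hv1 p.2, hv2 p.2⟩ ⟨by norm_num, by norm_num⟩ p.1.2.1
      (sub_nonneg.2 p.1.2.2) (by ring)
  have hn1 : ∀ p, 1 / 2 < ‖f p‖ := fun p => by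
    exact (hn01 p).1
  have hn2 : ∀ p, ‖f p‖ < 1 := fun p => by
    exact (hn01 p).2
  have hmem : ∀ p : unitInterval × ↥(h.outer ∩ Pᶜ),
      e ((h.coord ⟨p.2, p.2.2.2⟩).1, clampDisc (f p)) ∈ h.outer ∩ Pᶜ := fun p =>
    ⟨(h.mem_outer_iff _).2 (by rw [clampDisc_coe (hn2 p).le]; exact hn1 p),
      h.mem_compl_of_norm_lt (by rw [clampDisc_coe (hn2 p).le]; exact hn2 p)⟩
  refine ⟨⟨⟨fun p => ⟨_, hmem p⟩, ?_⟩, fun x => ?_, fun x => ?_⟩⟩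
  · exact (e.continuous.comp (by fun_prop)).subtype_mk _
  · refine Subtype.ext (congr_arg e (Prod.ext rfl (congr_arg clampDisc ?_)))
    change ((0 : ℝ) + (1 - (0 : ℝ)) * (3 / 4) * ‖v x‖⁻¹) • v x = (3 / 4 : ℝ) • ((‖v x‖⁻¹ : ℝ) • v x)
    rw [smul_smul]
    congr 1
    ring
  · refine Subtype.ext (Eq.trans (congr_arg e ?_) (h.apply_coord ⟨x.1, x.2.2⟩))
    refine Prod.ext rfl ?_
    change clampDisc (((1 : ℝ) + (1 - (1 : ℝ)) * (3 / 4) * ‖v x‖⁻¹) • v x) = _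
    rw [sub_self, zero_mul, zero_mul, add_zero, one_smul]
    exact clampDisc_self (h.coord ⟨x, x.2.2⟩).2

theorem isPathConnected_inter : IsPathConnected (h.outer ∩ Pᶜ) := by
  rw [isPathConnected_iff_pathConnectedSpace]
  obtain ⟨H⟩ := h.middle_comp_toTorus
  refine ⟨⟨h.middle 1⟩, fun x y => ?_⟩
  have hx : Joined (h.middle (h.toTorus x)) x := ⟨H.evalAt x⟩
  have hy : Joined (h.middle (h.toTorus y)) y := ⟨H.evalAt y⟩
  exact hx.symm.trans (((PathConnectedSpace.joined (h.toTorus x) (h.toTorus y)).map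
    h.middle.continuous).trans hy)

/-- The boundary torus. -/
def boundary : C(Torus, P) :=
  ⟨fun g => ⟨e (g.1, discBoundary g.2), (h.mem_iff _).2 (norm_discBoundary _)⟩,
    (e.continuous.comp (by fun_prop)).subtype_mk _⟩

theorem retract_comp_middle :
    (h.retract.comp ((ContinuousMap.inclusion inter_subset_left).comp h.middle)) = h.boundary := by
  ext g
  change h.deform (1, e (g.1, clampDisc ((3 / 4 : ℝ) • (g.2 : ℂ)))) = e (g.1, discBoundary g.2)
  have hn : ‖(3 / 4 : ℝ) • (g.2 : ℂ)‖ = 3 / 4 := by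
    rw [norm_smul, Circle.norm_coe, mul_one]; norm_num
  have hc : (clampDisc ((3 / 4 : ℝ) • (g.2 : ℂ)) : ℂ) = (3 / 4 : ℝ) • (g.2 : ℂ) :=
    clampDisc_coe (by rw [hn]; norm_num)
  rw [deform_apply]
  refine congr_arg e (Prod.ext rfl (Subtype.ext ?_))
  rw [(stretch_coe zero_le_one le_rfl (by rw [hc, hn]; norm_num)).1, hc, hn, smul_smul]
  norm_num
  rw [discBoundary_coe]

theorem toCore_comp_middle :
    (h.toCore.comp ((ContinuousMap.inclusion inter_subset_right).comp h.middle)) =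
      ContinuousMap.fst := by
  ext g
  change ((h.coord ⟨h.middle g, _⟩).1 : ℂ) = g.1
  have := h.coord_apply (h.middle g).2.2
  rw [show h.coord ⟨h.middle g, (h.middle g).2.2⟩ = _ from this]

/-- Every submodule is a kernel.  The `ℤ`-module structure is arbitrary: the one on homology is not
definitionally that of the additive group, which makes quotients of homology groups awkward. -/
theorem _root_.SLCount.exists_linearMap_ker_eq {M : Type} [AddCommGroup M] [Module ℤ M]
    (S : Submodule ℤ M) : ∃ (A : Type) (_ : AddCommGroup A) (_ : Module ℤ A) (q : M →ₗ[ℤ] A),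
      LinearMap.ker q = S :=
  ⟨M ⧸ S, inferInstance, Submodule.Quotient.module S, S.mkQ, S.ker_mkQ⟩

variable {u : H1 ℤ Circle}

/-- The homology of a Dehn filling: attaching a solid torus makes the class of its meridian zero and
has no other effect on the first homology group. -/
theorem surjective_and_ker (hu : Submodule.span ℤ {u} = ⊤) :
    Function.Surjective (H1map ℤ (incl P)) ∧ LinearMap.ker (H1map ℤ (incl P)) =
      Submodule.span ℤ {H1map ℤ (h.boundary.comp (sliceRight Circle 1)) u} := by
  set m := H1map ℤ (h.boundary.comp (sliceRight Circle 1)) u with hm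
  have hk : (incl P) = (incl h.outer).comp h.inclOuter := rfl
  have hkr : H1map ℤ h.inclOuter ∘ₗ H1map ℤ h.retract = LinearMap.id := by
    rw [← H1map_comp, H1map_eq_of_homotopic h.inclOuter_comp_retract, H1map_id]
  have hrk : H1map ℤ h.retract ∘ₗ H1map ℤ h.inclOuter = LinearMap.id := by
    rw [← H1map_comp, h.retract_comp_inclOuter, H1map_id]
  have hc : H1map ℤ h.core ∘ₗ H1map ℤ h.toCore = LinearMap.id := by
    rw [← H1map_comp, H1map_eq_of_homotopic h.core_comp_toCore, H1map_id]
  have hmid : H1map ℤ h.middle ∘ₗ H1map ℤ h.toTorus = LinearMap.id := by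
    rw [← H1map_comp, H1map_eq_of_homotopic h.middle_comp_toTorus, H1map_id]
  -- Scaling the second coordinate contracts the meridian in the solid torus and moves the core
  -- circle to a longitude.
  have hscale : ∀ f : C(Circle, Circle × Disc), (e.comp f).Homotopic
      (e.comp ⟨fun w => ((f w).1, discZero), by fun_prop⟩) := by
    intro f
    refine ⟨⟨⟨fun p => e ((f p.2).1, clampDisc ((1 - p.1 : ℝ) • ((f p.2).2 : ℂ))), by fun_prop⟩,
      fun w => ?_, fun w => ?_⟩⟩
    · change e ((f w).1, clampDisc ((1 - (0 : ℝ)) • ((f w).2 : ℂ))) = e (f w)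
      rw [sub_zero, one_smul, clampDisc_self]
    · change e ((f w).1, clampDisc ((1 - (1 : ℝ)) • ((f w).2 : ℂ))) = e ((f w).1, discZero)
      rw [sub_self, zero_smul]
      exact congr_arg e (Prod.ext rfl (Subtype.ext (clampDisc_coe (by simp))))
  have hmer : H1map ℤ (incl P) m = 0 := by
    rw [hm, ← LinearMap.comp_apply, ← H1map_comp]
    have h1 : (incl P).comp (h.boundary.comp (sliceRight Circle 1)) =
      e.comp ⟨fun w => (1, discBoundary w), by fun_prop⟩ := rfl
    have h2 : e.comp ⟨fun _ : Circle => ((1 : Circle), discZero), by fun_prop⟩ =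
      .const Circle (e (1, discZero)) := rfl
    rw [h1, H1map_eq_of_homotopic (hscale _)]
    change H1map ℤ (.const Circle (e (1, discZero))) u = 0
    rw [H1map_const, LinearMap.zero_apply]
  have hlong : H1map ℤ (incl Pᶜ) ∘ₗ H1map ℤ h.core =
      H1map ℤ (incl P) ∘ₗ H1map ℤ (h.boundary.comp (sliceLeft Circle 1)) := by
    rw [← H1map_comp, ← H1map_comp]
    have h1 : (incl P).comp (h.boundary.comp (sliceLeft Circle 1)) =
      e.comp ⟨fun w => (w, discBoundary 1), by fun_prop⟩ := rfl
    rw [h1, H1map_eq_of_homotopic (hscale _)]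
    rfl
  refine ⟨?_, le_antisymm ?_ ?_⟩
  · rw [← LinearMap.range_eq_top]
    obtain ⟨A, _, _, q, hq⟩ := exists_linearMap_ker_eq (LinearMap.range (H1map ℤ (incl P)))
    have hR : q ∘ₗ H1map ℤ (incl P) = 0 := LinearMap.range_le_ker_iff.1 hq.ge
    have hz := eq_zero_of_cover h.isOpen_outer h.isClosed.isOpen_compl h.outer_union_compl
      h.isPathConnected_inter q ?_ ?_
    · rw [← hq, hz, LinearMap.ker_zero]
    · rw [hk, H1map_comp] at hR
      rw [← LinearMap.comp_id (q ∘ₗ _), ← hkr, ← LinearMap.comp_assoc, LinearMap.comp_assoc _ _ q, hR,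
        LinearMap.zero_comp]
    · rw [← LinearMap.comp_id (q ∘ₗ _), ← hc, ← LinearMap.comp_assoc, LinearMap.comp_assoc _ _ q, hlong,
        ← LinearMap.comp_assoc _ _ q, hR, LinearMap.zero_comp, LinearMap.zero_comp]
  · obtain ⟨A, _, _, q, hq⟩ := exists_linearMap_ker_eq (Submodule.span ℤ {m})
    let σ := h.boundary.comp (sliceLeft Circle 1)
    obtain ⟨φ, hφ, -⟩ := exists_extension_of_cover h.isOpen_outer h.isClosed.isOpen_compl
      h.outer_union_compl (q ∘ₗ H1map ℤ h.retract)
      (q ∘ₗ H1map ℤ σ ∘ₗ H1map ℤ h.toCore) (by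
        have hb : q ∘ₗ H1map ℤ h.boundary =
            q ∘ₗ H1map ℤ σ ∘ₗ H1map ℤ (ContinuousMap.fst : C(Torus, Circle)) := by
          refine LinearMap.ext fun z => ?_
          obtain ⟨n, hn⟩ := exists_eq_zsmul_of_span hu
            (H1map ℤ (ContinuousMap.snd : C(Torus, Circle)) z)
          have hz := congr_arg (H1map ℤ h.boundary) (H1_prod_eq (1 : Circle) (1 : Circle) z)
          rw [map_add, ← LinearMap.comp_apply, ← LinearMap.comp_apply (H1map ℤ h.boundary),
            ← H1map_comp, ← H1map_comp, hn, map_zsmul] at hz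
          rw [LinearMap.comp_apply, hz, map_add, map_zsmul]
          have hmS : q m = 0 :=
            LinearMap.mem_ker.1 (hq ▸ Submodule.mem_span_singleton_self m)
          rw [← hm, hmS, zsmul_zero, add_zero]
          rfl
        refine LinearMap.ext fun z => ?_
        have hz : z = H1map ℤ h.middle (H1map ℤ h.toTorus z) :=
          (DFunLike.congr_fun hmid z).symm
        rw [hz]
        have e1 := DFunLike.congr_fun hb (H1map ℤ h.toTorus z)
        have e2 := congr_arg (H1map ℤ) h.retract_comp_middle
        have e3 := congr_arg (H1map ℤ) h.toCore_comp_middle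
        rw [H1map_comp, H1map_comp] at e2 e3
        rw [← e2, ← e3] at e1
        exact e1)
    intro x hx
    have h1 : φ (H1map ℤ (incl P) x) = q x := by
      rw [hk, H1map_comp, LinearMap.comp_apply, ← LinearMap.comp_apply φ, hφ, LinearMap.comp_apply,
        ← LinearMap.comp_apply (H1map ℤ h.retract), hrk, LinearMap.id_apply]
    rw [LinearMap.mem_ker.1 hx, map_zero] at h1
    exact hq ▸ LinearMap.mem_ker.2 h1.symm
  · rw [Submodule.span_le, singleton_subset_iff]
    exact hmer

end IsDehnFilling

/-! ### Counting -/

/-- The order of the quotient of `H` by the image of `m`, where `g : L → H` has a cyclic kernel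
generated by `κ`, and `m` generates the kernel of an epimorphism `χ : L → ℤ`. -/
theorem natCard_eq_natAbs_mul_index {L H Q : Type} [AddCommGroup L] [AddCommGroup H]
    [AddCommGroup Q] (g : L →+ H) {κ : L} (hg : g.ker = AddSubgroup.zmultiples κ) (χ : L →+ ℤ)
    (hχ : Function.Surjective χ) {m : L} (hχm : χ.ker = AddSubgroup.zmultiples m) (q : H →+ Q)
    (hq : Function.Surjective q) (hqm : q.ker = AddSubgroup.zmultiples (g m)) :
    Nat.card Q = (χ κ).natAbs * g.range.index := by
  have h1 : Nat.card Q = q.ker.index := by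
    rw [AddSubgroup.index_ker, q.range_eq_top_of_surjective hq, AddSubgroup.card_top]
  rw [h1, hqm, ← AddMonoidHom.map_zmultiples, AddSubgroup.index_map, hg, ← hχm, sup_comm,
    ← AddSubgroup.comap_map_eq, AddSubgroup.index_comap_of_surjective _ hχ,
    AddMonoidHom.map_zmultiples, Int.index_zmultiples]

/-- The coordinate homomorphisms `ℤ² → ℤ` that take the values `k 0`, `k 1`, `k 2` at
`(k 0, k 1)`, where `k 2 = -k 0 - k 1`. -/
def coordHom : Fin 3 → (ℤ × ℤ →+ ℤ) :=
  ![AddMonoidHom.fst ℤ ℤ, AddMonoidHom.snd ℤ ℤ, -AddMonoidHom.fst ℤ ℤ - AddMonoidHom.snd ℤ ℤ]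

/-- Generators of the kernels of the coordinate homomorphisms: the meridians of the three solid
tori. -/
def meridianVec : Fin 3 → ℤ × ℤ := ![(0, 1), (-1, 0), (1, -1)]

theorem coordHom_surjective (a : Fin 3) : Function.Surjective (coordHom a) := by
  intro n
  fin_cases a
  · exact ⟨(n, 0), rfl⟩
  · exact ⟨(0, n), rfl⟩
  · exact ⟨(-n, 0), by simp [coordHom]⟩

theorem ker_coordHom (a : Fin 3) :
    (coordHom a).ker = AddSubgroup.zmultiples (meridianVec a) := by
  ext ⟨x, y⟩
  rw [AddMonoidHom.mem_ker, AddSubgroup.mem_zmultiples_iff]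
  fin_cases a
  · simp only [coordHom, meridianVec, Fin.zero_eta, Matrix.cons_val_zero, AddMonoidHom.coe_fst,
      Prod.smul_mk, Prod.mk.injEq, smul_eq_mul, mul_zero, mul_one]
    exact ⟨fun h => ⟨y, h.symm, rfl⟩, fun ⟨_, h, _⟩ => h.symm⟩
  · simp only [coordHom, meridianVec, Fin.mk_one, Matrix.cons_val_one, Matrix.cons_val_zero,
      AddMonoidHom.coe_snd, Prod.smul_mk, Prod.mk.injEq, smul_eq_mul, mul_zero]
    exact ⟨fun h => ⟨-x, by ring, h.symm⟩, fun ⟨_, _, h⟩ => h.symm⟩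
  · have h1 : coordHom ⟨2, by norm_num⟩ (x, y) = -x - y := rfl
    have h2 : meridianVec ⟨2, by norm_num⟩ = (1, -1) := rfl
    rw [h1, h2]
    simp only [Prod.smul_mk, Prod.mk.injEq, smul_eq_mul]
    exact ⟨fun h => ⟨x, by ring, by linarith⟩, fun ⟨n, h, h'⟩ => by linarith⟩

theorem coordHom_apply {k : Fin 3 → ℤ} (hk : k 2 = -k 0 - k 1) (a : Fin 3) :
    coordHom a (k 0, k 1) = k a := by
  fin_cases a
  exacts [rfl, rfl, hk.symm]

/-- If the numbers `k a` have sum zero, then the positive and the negative ones have the same total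
absolute value. -/
theorem sum_pos_eq_sum_neg {k : Fin 3 → ℤ} (hk : k 2 = -k 0 - k 1) (c : ℤ) {f f' : Fin 3 → ℤ}
    (hf : ∀ a, 0 < k a → f a = (k a).natAbs * c) (hf' : ∀ a, k a < 0 → f' a = (k a).natAbs * c) :
    ∑ a with 0 < k a, f a = ∑ a with k a < 0, f' a := by
  have h1 : ∑ a with 0 < k a, f a = ∑ a, max (k a) 0 * c := by
    rw [Finset.sum_filter]
    refine Finset.sum_congr rfl fun a _ => ?_
    split_ifs with h
    · rw [hf a h, Int.natAbs_of_nonneg h.le, max_eq_left h.le]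
    · rw [max_eq_right (not_lt.1 h), zero_mul]
  have h2 : ∑ a with k a < 0, f' a = ∑ a, max (-k a) 0 * c := by
    rw [Finset.sum_filter]
    refine Finset.sum_congr rfl fun a _ => ?_
    split_ifs with h
    · rw [hf' a h, max_eq_left (by linarith), Int.ofNat_natAbs_of_nonpos h.le]
    · rw [max_eq_right (by linarith), zero_mul]
  have h3 : ∀ a, max (k a) 0 * c - max (-k a) 0 * c = k a * c := fun a => by
    rw [← sub_mul]
    congr 1
    rcases le_total 0 (k a) with h | h
    · rw [max_eq_left h, max_eq_right (by linarith)]; ring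
    · rw [max_eq_right h, max_eq_left (by linarith)]; ring
  rw [h1, h2, ← sub_eq_zero, ← Finset.sum_sub_distrib]
  simp only [h3]
  rw [← Finset.sum_mul, Fin.sum_univ_three, hk]
  ring

/-- The homomorphism from `ℤ²` to the first homology group of the torus given by the classes of the
coordinate circles; it is bijective if `u` generates the homology of the circle. -/
def torusHom (u : H1 ℤ Circle) : ℤ × ℤ →+ H1 ℤ Torus where
  toFun p := p.1 • H1map ℤ (sliceLeft Circle (1 : Circle)) u +
    p.2 • H1map ℤ (sliceRight Circle (1 : Circle)) u
  map_zero' := by simp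
  map_add' p q := by
    simp only [Prod.fst_add, Prod.snd_add, add_zsmul]
    abel

theorem torusHom_apply (u : H1 ℤ Circle) (p : ℤ × ℤ) : torusHom u p =
    p.1 • H1map ℤ (sliceLeft Circle (1 : Circle)) u +
      p.2 • H1map ℤ (sliceRight Circle (1 : Circle)) u := rfl

theorem torusHom_bijective {u : H1 ℤ Circle} (hu : Submodule.span ℤ {u} = ⊤) :
    Function.Bijective (torusHom u) := by
  constructor
  · rw [injective_iff_map_eq_zero]
    intro p hp
    exact Prod.ext (torus_repr_eq_zero hu hp).1 (torus_repr_eq_zero hu hp).2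
  · intro z
    obtain ⟨m, n, h⟩ := exists_torus_repr hu z
    exact ⟨(m, n), h.symm⟩

/-- The `ℤ`-module structure is arbitrary, but `n • y` is the multiple in the additive group. -/
theorem mem_span_singleton_iff_zsmul {M : Type} [AddCommGroup M] [hM : Module ℤ M] {x y : M} :
    x ∈ Submodule.span ℤ {y} ↔ ∃ n : ℤ, n • y = x := by
  rw [Submodule.mem_span_singleton]
  exact ⟨fun ⟨n, h⟩ => ⟨n, (int_smul_eq_zsmul hM n y).symm.trans h⟩,
    fun ⟨n, h⟩ => ⟨n, (int_smul_eq_zsmul hM n y).trans h⟩⟩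

/-- The order of the quotient of `H₁(P; ℤ)` by the image of a meridian, where `(k 0, k 1)` generates
the kernel of the map induced on homology by the inclusion `i` of the boundary torus. -/
theorem natCard_H1_eq {u : H1 ℤ Circle} (hu : Submodule.span ℤ {u} = ⊤) {P X : Type}
    [TopologicalSpace P] [TopologicalSpace X] (i : C(Torus, P)) {k : Fin 3 → ℤ}
    (hk : k 2 = -k 0 - k 1)
    (hi : Submodule.span ℤ {torusHom u (k 0, k 1)} = LinearMap.ker (H1map ℤ i)) (a : Fin 3)
    (q : H1 ℤ P →ₗ[ℤ] H1 ℤ X) (hq : Function.Surjective q)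
    (hqm : LinearMap.ker q = Submodule.span ℤ {H1map ℤ i (torusHom u (meridianVec a))}) :
    weight X = (k a).natAbs * (H1map ℤ i).toAddMonoidHom.range.index := by
  have hb := torusHom_bijective hu
  have h := natCard_eq_natAbs_mul_index (Q := H1 ℤ X)
    ((H1map ℤ i).toAddMonoidHom.comp (torusHom u)) (κ := (k 0, k 1)) ?_
    (coordHom a) (coordHom_surjective a) (ker_coordHom a) q.toAddMonoidHom hq ?_
  · rw [coordHom_apply hk] at h
    have hr : ((H1map ℤ i).toAddMonoidHom.comp (torusHom u)).range =
        (H1map ℤ i).toAddMonoidHom.range := by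
      rw [AddMonoidHom.range_comp, AddMonoidHom.range_eq_top_of_surjective _ hb.2,
        AddMonoidHom.range_eq_map]
    rw [hr] at h
    rw [weight, h]
    push_cast
    rfl
  · ext p
    have h1 : p ∈ ((H1map ℤ i).toAddMonoidHom.comp (torusHom u)).ker ↔
      torusHom u p ∈ LinearMap.ker (H1map ℤ i) := Iff.rfl
    rw [h1, ← hi, mem_span_singleton_iff_zsmul, AddSubgroup.mem_zmultiples_iff]
    refine exists_congr fun n => ?_
    rw [← map_zsmul, hb.1.eq_iff]
  · ext x
    have h1 : x ∈ q.toAddMonoidHom.ker ↔ x ∈ LinearMap.ker q := Iff.rfl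
    rw [h1, hqm, mem_span_singleton_iff_zsmul, AddSubgroup.mem_zmultiples_iff]
    rfl

/-! ### The local models as solid tori -/

theorem prod_coord (a : Fin 3) (z : C3) :
    z 0 * z 1 * z 2 = z a * (z (a + 1) * z (a + 2)) := by
  fin_cases a
  · change _ = z 0 * (z 1 * z 2); ring
  · change _ = z 1 * (z 2 * z 0); ring
  · change _ = z 2 * (z 0 * z 1); ring

theorem norm_sq_coord (a : Fin 3) (z : C3) :
    ‖z‖ ^ 2 = ‖z a‖ ^ 2 + ‖z (a + 1)‖ ^ 2 + ‖z (a + 2)‖ ^ 2 := by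
  rw [EuclideanSpace.norm_sq_eq, Fin.sum_univ_three]
  fin_cases a
  · change _ = ‖z 0‖ ^ 2 + ‖z 1‖ ^ 2 + ‖z 2‖ ^ 2; ring
  · change _ = ‖z 1‖ ^ 2 + ‖z 2‖ ^ 2 + ‖z 0‖ ^ 2; ring
  · change _ = ‖z 2‖ ^ 2 + ‖z 0‖ ^ 2 + ‖z 1‖ ^ 2; ring

theorem mem_modelL_iff {a : Fin 3} {s : ℝ} {z : C3} : z ∈ modelL a s ↔
    ‖z a‖ ^ 2 - s = ‖z (a + 1)‖ ^ 2 ∧ ‖z a‖ ^ 2 - s = ‖z (a + 2)‖ ^ 2 ∧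
      (z a * (z (a + 1) * z (a + 2))).im = 0 ∧ 0 ≤ (z a * (z (a + 1) * z (a + 2))).re := by
  rw [← prod_coord, ← and_assoc]
  refine and_congr_left fun _ => ⟨fun h => ⟨h _ ?_, h _ ?_⟩, fun h b hb => ?_⟩
  · fin_cases a <;> decide
  · fin_cases a <;> decide
  · have : b = a + 1 ∨ b = a + 2 := by
      fin_cases a <;> fin_cases b <;> first | exact absurd rfl hb | decide
    rcases this with rfl | rfl
    exacts [h.1, h.2]

theorem coord_cases (a j : Fin 3) : j = a ∨ j = a + 1 ∨ j = a + 2 := by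
  fin_cases a <;> fin_cases j <;> decide

/-- The common modulus of the coordinates `z_b`, `b ≠ a`, on the intersection of `L^a_s` with the
sphere of radius `ρ`. -/
def linkRadius (ρ s : ℝ) : ℝ := √((ρ ^ 2 - s) / 3)

theorem linkRadius_pos {ρ s : ℝ} (h : s < ρ ^ 2) : 0 < linkRadius ρ s :=
  Real.sqrt_pos.2 (by linarith)

theorem linkRadius_sq {ρ s : ℝ} (h : s ≤ ρ ^ 2) : linkRadius ρ s ^ 2 = (ρ ^ 2 - s) / 3 :=
  Real.sq_sqrt (by linarith)

/-- The parametrization of `L^a_s` by `S¹ × ℂ`: the argument of `z_a` is the angle `w` and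
`z_{a+1}` is a multiple of `v`, normalized so that `‖v‖ = 1` on the sphere of radius `ρ`. -/
def solidTorus (ρ : ℝ) (a : Fin 3) (s : ℝ) (w : Circle) (v : ℂ) : C3 :=
  WithLp.toLp 2 fun j =>
    if j = a then (√((linkRadius ρ s * ‖v‖) ^ 2 + s) : ℂ) * w
    else if j = a + 1 then (linkRadius ρ s : ℂ) * v
    else (linkRadius ρ s : ℂ) * (starRingEnd ℂ v * (w⁻¹ : Circle))

section

variable (ρ : ℝ) (a : Fin 3) (s : ℝ) (w : Circle) (v : ℂ)

theorem solidTorus_apply_self :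
    solidTorus ρ a s w v a = (√((linkRadius ρ s * ‖v‖) ^ 2 + s) : ℂ) * w :=
  if_pos rfl

theorem solidTorus_apply_add_one :
    solidTorus ρ a s w v (a + 1) = (linkRadius ρ s : ℂ) * v :=
  (if_neg (by fin_cases a <;> decide)).trans (if_pos rfl)

theorem solidTorus_apply_add_two :
    solidTorus ρ a s w v (a + 2) =
      (linkRadius ρ s : ℂ) * (starRingEnd ℂ v * (w⁻¹ : Circle)) :=
  (if_neg (by fin_cases a <;> decide)).trans (if_neg (by fin_cases a <;> decide))

theorem continuous_solidTorus :
    Continuous fun p : ℝ × Circle × ℂ => solidTorus ρ a p.1 p.2.1 p.2.2 := by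
  have hR : Continuous (linkRadius ρ) := by unfold linkRadius; fun_prop
  have hc : Continuous fun z : Circle => (z : ℂ) := by fun_prop
  have hconj : Continuous (starRingEnd ℂ) := Complex.continuous_conj
  refine (PiLp.continuous_toLp 2 _).comp (continuous_pi fun j => ?_)
  rcases coord_cases a j with rfl | rfl | rfl
  · simp only [if_true]
    have h1 : Continuous fun p : ℝ × Circle × ℂ =>
        √((linkRadius ρ p.1 * ‖p.2.2‖) ^ 2 + p.1) := by fun_prop
    exact (Complex.continuous_ofReal.comp h1).mul (hc.comp (by fun_prop))
  · have h : a + 1 ≠ a := by fin_cases a <;> decide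
    simp only [if_neg h, if_true]
    exact (Complex.continuous_ofReal.comp (hR.comp continuous_fst)).mul (by fun_prop)
  · have h : a + 2 ≠ a := by fin_cases a <;> decide
    have h' : a + 2 ≠ a + 1 := by fin_cases a <;> decide
    simp only [if_neg h, if_neg h']
    exact (Complex.continuous_ofReal.comp (hR.comp continuous_fst)).mul
      ((hconj.comp (by fun_prop)).mul (hc.comp (by fun_prop)))

theorem continuous_solidTorus_comp {Y : Type} [TopologicalSpace Y] {f : Y → ℝ} {g : Y → Circle}
    {h : Y → ℂ} (hf : Continuous f) (hg : Continuous g) (hh : Continuous h) :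
    Continuous fun y => solidTorus ρ a (f y) (g y) (h y) := by
  have := (continuous_solidTorus ρ a).comp (hf.prodMk (hg.prodMk hh))
  simpa only [Function.comp_def] using this

variable {ρ s}

theorem norm_solidTorus_sq (hs : 0 ≤ s) (hρ : s ≤ ρ ^ 2) :
    ‖solidTorus ρ a s w v‖ ^ 2 = (ρ ^ 2 - s) * ‖v‖ ^ 2 + s := by
  have h0 : 0 ≤ (linkRadius ρ s * ‖v‖) ^ 2 + s := by positivity
  rw [norm_sq_coord a, solidTorus_apply_self, solidTorus_apply_add_one, solidTorus_apply_add_two]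
  simp only [norm_mul, Circle.norm_coe, mul_one, Complex.norm_real, RCLike.norm_conj,
    Real.norm_eq_abs, mul_pow, sq_abs]
  rw [mul_pow] at h0
  rw [Real.sq_sqrt h0, linkRadius_sq hρ]
  ring

theorem solidTorus_mem_modelL (hs : 0 ≤ s) : solidTorus ρ a s w v ∈ modelL a s := by
  have h0 : 0 ≤ (linkRadius ρ s * ‖v‖) ^ 2 + s := by positivity
  have hw : (w : ℂ) ≠ 0 := Circle.coe_ne_zero w
  have hR : 0 ≤ linkRadius ρ s := Real.sqrt_nonneg _
  have hprod : solidTorus ρ a s w v a *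
      (solidTorus ρ a s w v (a + 1) * solidTorus ρ a s w v (a + 2)) =
      ((√((linkRadius ρ s * ‖v‖) ^ 2 + s) * (linkRadius ρ s * ‖v‖) ^ 2 : ℝ) : ℂ) := by
    rw [solidTorus_apply_self, solidTorus_apply_add_one, solidTorus_apply_add_two, Circle.coe_inv]
    have h := Complex.mul_conj' v
    push_cast
    rw [mul_pow (linkRadius ρ s : ℂ), ← h]
    field_simp
  rw [mem_modelL_iff, hprod, Complex.ofReal_im, Complex.ofReal_re, solidTorus_apply_self,
    solidTorus_apply_add_one, solidTorus_apply_add_two]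
  simp only [norm_mul, Circle.norm_coe, mul_one, Complex.norm_real, RCLike.norm_conj,
    Real.norm_eq_abs, mul_pow, sq_abs]
  rw [mul_pow] at h0
  rw [Real.sq_sqrt h0]
  exact ⟨by ring, by ring, trivial, by positivity⟩

theorem norm_solidTorus_le (hs : 0 ≤ s) (hρ : s ≤ ρ ^ 2) (h0 : 0 ≤ ρ) (hv : ‖v‖ ≤ 1) :
    ‖solidTorus ρ a s w v‖ ≤ ρ := by
  refine (sq_le_sq₀ (norm_nonneg _) h0).1 ?_
  rw [norm_solidTorus_sq a w v hs hρ]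
  have : ‖v‖ ^ 2 ≤ 1 := by nlinarith [norm_nonneg v]
  nlinarith

theorem norm_solidTorus_eq_iff (hs : 0 ≤ s) (hρ : s < ρ ^ 2) (h0 : 0 ≤ ρ) :
    ‖solidTorus ρ a s w v‖ = ρ ↔ ‖v‖ = 1 := by
  rw [← sq_eq_sq₀ (norm_nonneg _) h0, norm_solidTorus_sq a w v hs hρ.le,
    ← sq_eq_sq₀ (norm_nonneg v) zero_le_one, one_pow]
  constructor
  · intro h
    exact mul_left_cancel₀ (sub_pos.2 hρ).ne' (by linarith)
  · intro h
    rw [h]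
    ring

end

theorem solidTorus_injective {ρ : ℝ} (a : Fin 3) {s : ℝ} (hs : 0 < s) (hρ : s < ρ ^ 2)
    {w w' : Circle} {v v' : ℂ} (h : solidTorus ρ a s w v = solidTorus ρ a s w' v') :
    w = w' ∧ v = v' := by
  have hR : (linkRadius ρ s : ℂ) ≠ 0 := Complex.ofReal_ne_zero.2 (linkRadius_pos hρ).ne'
  have h1 : v = v' := by
    have := congrArg (fun z : C3 => z (a + 1)) h
    simp only [solidTorus_apply_add_one] at this
    exact mul_left_cancel₀ hR this
  subst h1
  refine ⟨Subtype.ext ?_, rfl⟩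
  have hr : (√((linkRadius ρ s * ‖v‖) ^ 2 + s) : ℂ) ≠ 0 :=
    Complex.ofReal_ne_zero.2 (Real.sqrt_pos.2 (by positivity)).ne'
  have := congrArg (fun z : C3 => z a) h
  simp only [solidTorus_apply_self] at this
  exact mul_left_cancel₀ hr this

theorem exists_solidTorus_eq {ρ : ℝ} {a : Fin 3} {s : ℝ} (hs : 0 < s)
    (hρ : s < ρ ^ 2) {z : C3} (hz : z ∈ modelL a s) (hz' : ‖z‖ ≤ ρ) :
    ∃ (w : Circle) (v : ℂ), ‖v‖ ≤ 1 ∧ solidTorus ρ a s w v = z := by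
  obtain ⟨hx, hy, him, hre⟩ := mem_modelL_iff.1 hz
  have hR := linkRadius_pos hρ
  have hRc : (linkRadius ρ s : ℂ) ≠ 0 := Complex.ofReal_ne_zero.2 hR.ne'
  have hsum := norm_sq_coord a z
  have hnz : ‖z‖ ^ 2 ≤ ρ ^ 2 := pow_le_pow_left₀ (norm_nonneg z) hz' 2
  have hza : z a ≠ 0 := by
    intro h
    rw [h, norm_zero] at hx
    nlinarith [sq_nonneg ‖z (a + 1)‖]
  have hna : (‖z a‖ : ℂ) ≠ 0 := Complex.ofReal_ne_zero.2 (norm_ne_zero_iff.2 hza)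
  have hxy : ‖z (a + 1)‖ = ‖z (a + 2)‖ :=
    (sq_eq_sq₀ (norm_nonneg _) (norm_nonneg _)).1 (hx.symm.trans hy)
  have hdir : z a = ‖z a‖ * (direction (z a) hza : ℂ) := by
    rw [direction_coe, Complex.real_smul, Complex.ofReal_inv, mul_inv_cancel_left₀ hna]
  have hnv : linkRadius ρ s * ‖z (a + 1) / linkRadius ρ s‖ = ‖z (a + 1)‖ := by
    rw [norm_div, Complex.norm_real, Real.norm_of_nonneg hR.le, mul_div_cancel₀ _ hR.ne']
  refine ⟨direction (z a) hza, z (a + 1) / linkRadius ρ s, ?_, ?_⟩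
  · have h1 : ‖z (a + 1)‖ ^ 2 ≤ linkRadius ρ s ^ 2 := by
      rw [linkRadius_sq hρ.le]
      nlinarith
    have h2 : ‖z (a + 1)‖ ≤ linkRadius ρ s := (sq_le_sq₀ (norm_nonneg _) hR.le).1 h1
    rw [norm_div, Complex.norm_real, Real.norm_of_nonneg hR.le]
    exact (div_le_one hR).2 h2
  · set w := direction (z a) hza with hw
    have hw0 : (w : ℂ) ≠ 0 := Circle.coe_ne_zero w
    ext j
    rcases coord_cases a j with rfl | rfl | rfl
    · rw [solidTorus_apply_self, hnv, ← hx, sub_add_cancel, Real.sqrt_sq (norm_nonneg _)]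
      exact hdir.symm
    · rw [solidTorus_apply_add_one, mul_div_cancel₀ _ hRc]
    · rw [solidTorus_apply_add_two, map_div₀, Complex.conj_ofReal, Circle.coe_inv]
      -- The product of the coordinates is its own modulus.
      have hp : z a * (z (a + 1) * z (a + 2)) = (‖z a‖ * (‖z (a + 1)‖ * ‖z (a + 1)‖) : ℝ) := by
        have h1 : z a * (z (a + 1) * z (a + 2)) =
            ((z a * (z (a + 1) * z (a + 2))).re : ℂ) := Complex.ext rfl him
        have h2 : ‖z a * (z (a + 1) * z (a + 2))‖ = (z a * (z (a + 1) * z (a + 2))).re := by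
          rw [h1, Complex.norm_real, Real.norm_of_nonneg hre, Complex.ofReal_re]
        rw [h1, ← h2, norm_mul, norm_mul, ← hxy]
      by_cases h0 : z (a + 1) = 0
      · have h2 : z (a + 2) = 0 := by
          rw [← norm_eq_zero, ← hxy, h0, norm_zero]
        rw [h0, h2]
        simp
      · have h3 : (w : ℂ) * z (a + 2) = starRingEnd ℂ (z (a + 1)) := by
          have h4 := Complex.mul_conj' (z (a + 1))
          refine mul_left_cancel₀ hna (mul_left_cancel₀ h0 ?_)
          have h5 : (‖z a‖ : ℂ) * w * (z (a + 1) * z (a + 2)) =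
              ‖z a‖ * (‖z (a + 1)‖ * ‖z (a + 1)‖) := by
            rw [← hdir, hp]
            push_cast
            ring
          linear_combination h5 - (‖z a‖ : ℂ) * h4
        rw [← h3]
        field_simp

/-- The automorphisms of the torus that convert the parametrization of the boundary of the solid
torus by `(arg z_a, arg z_{a+1})` into the one by the arguments of the first two coordinates; the
three arguments have sum zero. -/
def change (a : Fin 3) : C(Torus, Torus) :=
  match a with
  | 0 => ⟨fun g => (g.1, g.2), by fun_prop⟩
  | 1 => ⟨fun g => (g.2⁻¹ * g.1⁻¹, g.1), by fun_prop⟩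
  | 2 => ⟨fun g => (g.2, g.1⁻¹ * g.2⁻¹), by fun_prop⟩

theorem solidTorus_zero {ρ : ℝ} (hρ : 0 < ρ) (a : Fin 3) (g : Torus) :
    solidTorus ρ a 0 g.1 g.2 = linkPoint ρ (change a g) := by
  have h0 : linkRadius ρ 0 = ρ / √3 := by
    rw [linkRadius, sub_zero, Real.sqrt_div (sq_nonneg ρ), Real.sqrt_sq hρ.le]
  have hpos : 0 ≤ ρ / √3 := by positivity
  have hself : solidTorus ρ a 0 g.1 g.2 a = ((ρ / √3 : ℝ) : ℂ) * g.1 := by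
    rw [solidTorus_apply_self, h0, Circle.norm_coe, mul_one, add_zero, Real.sqrt_sq hpos]
  have h1 : solidTorus ρ a 0 g.1 g.2 (a + 1) = ((ρ / √3 : ℝ) : ℂ) * g.2 := by
    rw [solidTorus_apply_add_one, h0]
  have h2 : solidTorus ρ a 0 g.1 g.2 (a + 2) =
      ((ρ / √3 : ℝ) : ℂ) * ((g.1⁻¹ * g.2⁻¹ : Circle) : ℂ) := by
    rw [solidTorus_apply_add_two, h0, ← Circle.coe_inv_eq_conj, Circle.coe_mul, mul_comm (_ : ℂ) _]
    ring
  have e1 : g.2 = (g.2⁻¹ * g.1⁻¹)⁻¹ * g.1⁻¹ := by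
    rw [mul_inv, inv_inv, inv_inv, mul_inv_cancel_right]
  have e2 : g.1 = g.2⁻¹ * (g.1⁻¹ * g.2⁻¹)⁻¹ := by
    rw [mul_inv, inv_inv, inv_inv, mul_comm, mul_inv_cancel_right]
  fin_cases a <;> ext j <;> fin_cases j
  · exact hself
  · exact h1
  · exact h2
  · exact h2.trans (by rw [mul_comm g.1⁻¹]; rfl)
  · exact hself
  · exact h1.trans (congrArg (fun x : Circle => ((ρ / √3 : ℝ) : ℂ) * x) e1)
  · exact h1
  · exact h2
  · exact hself.trans (congrArg (fun x : Circle => ((ρ / √3 : ℝ) : ℂ) * x) e2)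

/-! ### The compact piece of the singular 3-fold -/

section Geometry

variable {M : Type} [TopologicalSpace M] [ChartedSpace C3 M]

/-- The inverse function theorem for maps from `ℂ³` to a manifold of the same dimension. -/
theorem map_nhds_eq_of_injective_mfderiv {f : C3 → M} {z : C3}
    (hf : ContMDiffAt 𝓘(ℝ, C3) 𝓘(ℝ, C3) 1 f z)
    (hinj : Function.Injective (mfderiv 𝓘(ℝ, C3) 𝓘(ℝ, C3) f z)) :
    𝓝 (f z) ≤ Filter.map f (𝓝 z) := by
  set φ := extChartAt 𝓘(ℝ, C3) (f z) with hφ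
  have hd : ContDiffAt ℝ 1 (φ ∘ f) z := by
    have h := (contMDiffAt_iff.1 hf).2
    simp only [mfld_simps, contDiffWithinAt_univ] at h
    exact h
  have hm : mfderiv 𝓘(ℝ, C3) 𝓘(ℝ, C3) f z = fderiv ℝ (φ ∘ f) z := by
    rw [(hf.mdifferentiableAt one_ne_zero).mfderiv]
    simp only [writtenInExtChartAt, mfld_simps, fderivWithin_univ]
    rfl
  rw [hm] at hinj
  have hsurj : Function.Surjective (fderiv ℝ (φ ∘ f) z) :=
    (LinearMap.injective_iff_surjective (K := ℝ) (V := C3)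
      (f := (fderiv ℝ (φ ∘ f) z).toLinearMap)).1 hinj
  have hmap := (hd.hasStrictFDerivAt one_ne_zero).map_nhds_eq_of_surj
    (LinearMap.range_eq_top.2 hsurj)
  intro V hV
  have hs : f ⁻¹' φ.source ∈ 𝓝 z :=
    hf.continuousAt.preimage_mem_nhds (extChartAt_source_mem_nhds (I := 𝓘(ℝ, C3)) (f z))
  have himg : (φ ∘ f) '' (f ⁻¹' V ∩ f ⁻¹' φ.source) ∈ 𝓝 (φ (f z)) := by
    have : 𝓝 (φ (f z)) = Filter.map (φ ∘ f) (𝓝 z) := hmap.symm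
    rw [this]
    exact Filter.image_mem_map (Filter.inter_mem hV hs)
  have hpre := (continuousAt_extChartAt (I := 𝓘(ℝ, C3)) (f z)).preimage_mem_nhds himg
  filter_upwards [hpre, extChartAt_source_mem_nhds (I := 𝓘(ℝ, C3)) (f z)] with x hx hxs
  obtain ⟨y, ⟨hyV, hys⟩, hxy⟩ := hx
  rw [← φ.injOn hys hxs hxy]
  exact hyV

namespace ConeSingularity

variable {A : AlmostCY M} (S : ConeSingularity A)

theorem isOpen_image_ball : IsOpen (S.Φ '' ball 0 S.ρ) := by
  rw [isOpen_iff_mem_nhds]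
  rintro _ ⟨z, hz, rfl⟩
  have hn : closedBall (0 : C3) S.ρ ∈ 𝓝 z :=
    Filter.mem_of_superset (isOpen_ball.mem_nhds hz) ball_subset_closedBall
  have hinj := S.Φ_immersion z (ball_subset_closedBall hz)
  rw [dBall, mfderivWithin_of_mem_nhds hn] at hinj
  exact map_nhds_eq_of_injective_mfderiv (S.Φ_C1.contMDiffAt hn) hinj
    (Filter.image_mem_map (isOpen_ball.mem_nhds hz))

theorem isCompact_P : IsCompact S.P := S.compact.diff S.isOpen_image_ball

end ConeSingularity

end Geometry

/-! ### Lifting homotopies through an isotopy -/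

/-- A homotopy that stays, at each time, in the image of an isotopy of embeddings of a compact
space factors continuously through the isotopy. -/
theorem exists_lift_through_isotopy {X Y Z : Type} [TopologicalSpace X] [TopologicalSpace Y]
    [TopologicalSpace Z] [CompactSpace X] [T2Space Z] (Ψ : C(unitInterval × X, Z))
    (hΨ : ∀ τ, Function.Injective fun x => Ψ (τ, x)) (Θ : C(unitInterval × Y, Z))
    (h : ∀ q, ∃ x, Ψ (q.1, x) = Θ q) :
    ∃ H : C(unitInterval × Y, X), ∀ q, Ψ (q.1, H q) = Θ q := by
  have hF : Topology.IsClosedEmbedding fun p : unitInterval × X => (p.1, Ψ p) := by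
    refine Continuous.isClosedEmbedding (by fun_prop) ?_
    rintro ⟨τ, x⟩ ⟨τ', x'⟩ hp
    obtain rfl : τ = τ' := (Prod.ext_iff.1 hp).1
    rw [hΨ τ (Prod.ext_iff.1 hp).2]
  choose H hH using h
  have hc : Continuous fun q : unitInterval × Y => (q.1, H q) := by
    rw [hF.isInducing.continuous_iff]
    have : (fun p : unitInterval × X => (p.1, Ψ p)) ∘ (fun q => (q.1, H q)) =
        fun q : unitInterval × Y => (q.1, Θ q) := funext fun q => Prod.ext rfl (hH q)
    rw [this]
    fun_prop
  exact ⟨⟨H, continuous_snd.comp hc⟩, hH⟩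

/-! ### The desingularizations as Dehn fillings -/

/-- The meridians of the solid tori, in the homology of the torus. -/
theorem H1map_change_meridian (u : H1 ℤ Circle) (a : Fin 3) :
    H1map ℤ ((change a).comp (sliceRight Circle 1)) u = torusHom u (meridianVec a) := by
  rw [torusHom_apply]
  fin_cases a
  · have h : (change 0).comp (sliceRight Circle 1) = sliceRight Circle 1 := rfl
    change H1map ℤ ((change 0).comp (sliceRight Circle 1)) u = (0 : ℤ) • _ + (1 : ℤ) • _
    rw [h, zero_zsmul, one_zsmul, zero_add]
  · have h : (change 1).comp (sliceRight Circle 1) = (sliceLeft Circle (1 : Circle))⁻¹ := by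
      ext z : 1
      refine Prod.ext ?_ ?_
      · change z⁻¹ * 1⁻¹ = z⁻¹
        rw [inv_one, mul_one]
      · change (1 : Circle) = 1⁻¹
        rw [inv_one]
    change H1map ℤ ((change 1).comp (sliceRight Circle 1)) u = (-1 : ℤ) • _ + (0 : ℤ) • _
    rw [h, H1map_inv, zero_zsmul, neg_one_zsmul, add_zero]
    rfl
  · have h : (change 2).comp (sliceRight Circle 1) =
        sliceLeft Circle (1 : Circle) * (sliceRight Circle (1 : Circle))⁻¹ := by
      ext z : 1
      refine Prod.ext ?_ ?_
      · change z = z * 1⁻¹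
        rw [inv_one, mul_one]
      · change 1⁻¹ * z⁻¹ = 1 * z⁻¹
        rw [inv_one]
    change H1map ℤ ((change 2).comp (sliceRight Circle 1)) u = (1 : ℤ) • _ + (-1 : ℤ) • _
    rw [h, H1map_mul, H1map_inv, one_zsmul, neg_one_zsmul]
    rfl

section Geometry

variable {M : Type} [TopologicalSpace M] [ChartedSpace C3 M] {A : ℝ → AlmostCY M}
  {ε : ℝ} {S : ConeSingularity (A 0)} {k : Fin 3 → ℤ} (D : Desingularization A ε S k)
  {a : Fin 3} {t : ℝ}

theorem mul_mem_params {δ : ℝ} (ht : t ∈ params k δ a) {τ : ℝ} (h0 : 0 < τ) (h1 : τ ≤ 1) :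
    τ * t ∈ params k δ a := by
  refine ⟨lt_of_le_of_lt ?_ ht.1, ?_⟩
  · rw [abs_mul, abs_of_pos h0]
    exact mul_le_of_le_one_left (abs_nonneg t) h1
  · rw [mul_left_comm]
    exact mul_pos h0 ht.2

theorem div_pos_of_mem_params {δ : ℝ} (ht : t ∈ params k δ a) : 0 < t / (k a * Real.pi) := by
  have h : (k a : ℝ) ≠ 0 := left_ne_zero_of_mul ht.2.ne'
  have h1 : t / (k a * Real.pi) = k a * t / ((k a : ℝ) ^ 2 * Real.pi) := by
    field_simp
  rw [h1]
  exact div_pos ht.2 (mul_pos (by positivity) Real.pi_pos)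

namespace Desingularization

theorem solidTorus_mem_closedBall (ht : t ∈ params k D.δ a) (w : Circle) {v : ℂ} (hv : ‖v‖ ≤ 1) :
    solidTorus S.ρ a (t / (k a * Real.pi)) w v ∈ closedBall (0 : C3) S.ρ :=
  mem_closedBall_zero_iff.2 (norm_solidTorus_le a w v (div_pos_of_mem_params ht).le
    (D.δ_small a t ht).le S.ρ_pos.le hv)

theorem solidTorus_mem_ball_iff (ht : t ∈ params k D.δ a) (w : Circle) {v : ℂ} (hv : ‖v‖ ≤ 1) :
    D.Φ a t (solidTorus S.ρ a (t / (k a * Real.pi)) w v) ∈ D.Φ a t '' ball 0 S.ρ ↔ ‖v‖ ≠ 1 := by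
  rw [(D.Φ_injOn a t ht).mem_image_iff ball_subset_closedBall
    (D.solidTorus_mem_closedBall ht w hv), mem_ball_zero_iff,
    Ne, ← norm_solidTorus_eq_iff a w v (div_pos_of_mem_params ht).le (D.δ_small a t ht) S.ρ_pos.le]
  exact (mem_closedBall_zero_iff.1 (D.solidTorus_mem_closedBall ht w hv)).lt_iff_ne

theorem solidTorus_mem_N (ht : t ∈ params k D.δ a) (w : Circle) {v : ℂ} (hv : ‖v‖ ≤ 1) :
    D.Φ a t (solidTorus S.ρ a (t / (k a * Real.pi)) w v) ∈ D.N a t :=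
  (D.Φ_model a t ht _ (D.solidTorus_mem_closedBall ht w hv)).2
    (solidTorus_mem_modelL a w v (div_pos_of_mem_params ht).le)

/-- The part `N^a_t \ Φ^a_t(B_ρ)` of `N^a_t`. -/
def outside (a : Fin 3) (t : ℝ) : Set (D.N a t) := {x | (x : M) ∉ D.Φ a t '' ball 0 S.ρ}

theorem continuousOn_Ψ (ht : t ∈ params k D.δ a) : ContinuousOn (D.Ψ a t) S.P :=
  (D.Ψ_cont a).comp (f := fun p : M => (t, p)) (by fun_prop)
    fun _ hp => ⟨mem_insert_of_mem _ ht, hp⟩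

theorem continuousOn_Φ (ht : t ∈ params k D.δ a) :
    ContinuousOn (D.Φ a t) (closedBall 0 S.ρ) :=
  (D.Φ_cont a).comp (f := fun z : C3 => (t, z)) (by fun_prop)
    fun _ hz => ⟨mem_insert_of_mem _ ht, hz⟩

/-- The map `Ψ^a_t`, as a continuous map from `P` to `N^a_t \ Φ^a_t(B_ρ)`. -/
def transfer (ht : t ∈ params k D.δ a) : C(S.P, D.outside a t) where
  toFun p := ⟨⟨D.Ψ a t p, ((D.Ψ_bijOn a t ht).mapsTo p.2).1⟩, ((D.Ψ_bijOn a t ht).mapsTo p.2).2⟩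
  continuous_toFun := Continuous.subtype_mk
    (Continuous.subtype_mk (continuousOn_iff_continuous_domRestrict.1 (D.continuousOn_Ψ ht)) _) _

theorem isClosed_outside [T2Space M] (ht : t ∈ params k D.δ a) : IsClosed (D.outside a t) := by
  have h : D.outside a t = Subtype.val ⁻¹' (D.Ψ a t '' S.P) := by
    ext x
    rw [(D.Ψ_bijOn a t ht).image_eq]
    exact ⟨fun hx => ⟨x.2, hx⟩, fun hx => hx.2⟩
  rw [h]
  exact (S.isCompact_P.image_of_continuousOn (D.continuousOn_Ψ ht)).isClosed.preimage
    continuous_subtype_val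

theorem H1map_transfer_bijective [T2Space M] (ht : t ∈ params k D.δ a) :
    Function.Bijective (H1map ℤ (D.transfer ht)) := by
  have : CompactSpace S.P := isCompact_iff_compactSpace.1 S.isCompact_P
  have hb : Function.Bijective (D.transfer ht) := by
    constructor
    · intro p p' h
      exact Subtype.ext ((D.Ψ_bijOn a t ht).injOn p.2 p'.2
        (congrArg (fun x : D.outside a t => (x : M)) h))
    · intro x
      obtain ⟨p, hp, h⟩ := (D.Ψ_bijOn a t ht).surjOn ⟨x.1.2, x.2⟩
      exact ⟨⟨p, hp⟩, Subtype.ext (Subtype.ext h)⟩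
  exact H1map_bijective_of_homeomorph
    (Continuous.homeoOfEquivCompactToT2 (f := Equiv.ofBijective _ hb) (D.transfer ht).continuous)

/-- The solid torus `N^a_t ∩ Φ^a_t(B_ρ)`. -/
def core (ht : t ∈ params k D.δ a) : C(Circle × Disc, D.N a t) where
  toFun q := ⟨D.Φ a t (solidTorus S.ρ a (t / (k a * Real.pi)) q.1 q.2),
    D.solidTorus_mem_N ht q.1 (norm_disc_le q.2)⟩
  continuous_toFun := by
    have h : Continuous fun q : Circle × Disc =>
        solidTorus S.ρ a (t / (k a * Real.pi)) q.1 q.2 :=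
      continuous_solidTorus_comp S.ρ a continuous_const continuous_fst
        (continuous_subtype_val.comp continuous_snd)
    exact Continuous.subtype_mk ((D.continuousOn_Φ ht).comp_continuous h
      fun q => D.solidTorus_mem_closedBall ht q.1 (norm_disc_le q.2)) _

theorem isDehnFilling [T2Space M] (ht : t ∈ params k D.δ a) :
    IsDehnFilling (D.outside a t) (D.core ht) where
  isClosed := D.isClosed_outside ht
  injective q q' h := by
    have h1 := D.Φ_injOn a t ht (D.solidTorus_mem_closedBall ht q.1 (norm_disc_le q.2))
      (D.solidTorus_mem_closedBall ht q'.1 (norm_disc_le q'.2)) (congrArg Subtype.val h)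
    have h2 := solidTorus_injective a (div_pos_of_mem_params ht) (D.δ_small a t ht) h1
    exact Prod.ext h2.1 (Subtype.ext h2.2)
  cover x := by
    by_cases hx : x ∈ D.outside a t
    · exact Or.inl hx
    obtain ⟨z, hz, hzx⟩ : (x : M) ∈ D.Φ a t '' ball 0 S.ρ := not_not.1 hx
    have hz' := ball_subset_closedBall hz
    have hm : z ∈ modelL a (t / (k a * Real.pi)) :=
      (D.Φ_model a t ht z hz').1 (hzx ▸ x.2)
    obtain ⟨w, v, hv, h⟩ := exists_solidTorus_eq (div_pos_of_mem_params ht) (D.δ_small a t ht) hm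
      (mem_closedBall_zero_iff.1 hz')
    exact Or.inr ⟨(w, ⟨v, mem_closedBall_zero_iff.2 hv⟩), Subtype.ext ((congrArg _ h).trans hzx)⟩
  mem_iff q := (not_congr (D.solidTorus_mem_ball_iff ht q.1 (norm_disc_le q.2))).trans not_not

theorem mul_mem_insert (ht : t ∈ params k D.δ a) (τ : unitInterval) :
    (τ : ℝ) * t ∈ insert 0 (params k D.δ a) := by
  rcases τ.2.1.eq_or_lt with h | h
  · rw [← h, zero_mul]
    exact mem_insert _ _
  · exact mem_insert_of_mem _ (mul_mem_params ht h τ.2.2)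

theorem link_mem_closedBall (ht : t ∈ insert 0 (params k D.δ a)) (g : Torus) :
    solidTorus S.ρ a (t / (k a * Real.pi)) g.1 g.2 ∈ closedBall (0 : C3) S.ρ := by
  rcases ht with rfl | ht
  · rw [zero_div, solidTorus_zero S.ρ_pos]
    exact S.linkPoint_mem_closedBall _
  · exact D.solidTorus_mem_closedBall ht g.1 (Circle.norm_coe _).le

/-- As `t → 0`, the boundary of the solid torus in `N^a_t` is deformed to the boundary of `P`. -/
theorem exists_homotopic_boundary [T2Space M] (ht : t ∈ params k D.δ a) : ∃ β : C(Torus, S.P),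
    (S.ι.comp (change a)).Homotopic β ∧ (D.transfer ht).comp β = (D.isDehnFilling ht).boundary := by
  have : CompactSpace S.P := isCompact_iff_compactSpace.1 S.isCompact_P
  let Ψ : C(unitInterval × S.P, M) := ⟨fun q => D.Ψ a (q.1 * t) q.2,
    (D.Ψ_cont a).comp_continuous (f := fun q : unitInterval × S.P => ((q.1 : ℝ) * t, (q.2 : M)))
      (by fun_prop) fun q => ⟨D.mul_mem_insert ht q.1, q.2.2⟩⟩
  let Θ : C(unitInterval × Torus, M) :=
    ⟨fun q => D.Φ a (q.1 * t) (solidTorus S.ρ a (q.1 * t / (k a * Real.pi)) q.2.1 q.2.2),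
    (D.Φ_cont a).comp_continuous (f := fun q : unitInterval × Torus =>
        ((q.1 : ℝ) * t, solidTorus S.ρ a (q.1 * t / (k a * Real.pi)) q.2.1 q.2.2))
      (Continuous.prodMk (by fun_prop) (continuous_solidTorus_comp S.ρ a
        (by fun_prop) (by fun_prop) (by fun_prop)))
      fun q => ⟨D.mul_mem_insert ht q.1, D.link_mem_closedBall (D.mul_mem_insert ht q.1) q.2⟩⟩
  have hΘ0 : ∀ g, Θ (0, g) = S.ι (change a g) := fun g => by
    change D.Φ a ((0 : ℝ) * t) (solidTorus S.ρ a ((0 : ℝ) * t / (k a * Real.pi)) g.1 g.2) =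
      S.Φ (linkPoint S.ρ (change a g))
    rw [zero_mul, zero_div, solidTorus_zero S.ρ_pos,
      D.Φ_zero a (S.linkPoint_mem_closedBall _)]
  have hΨ0 : ∀ p, Ψ (0, p) = p := fun p => by
    change D.Ψ a ((0 : ℝ) * t) p = p
    rw [zero_mul, D.Ψ_zero a p.2, id]
  have hτ : ∀ τ : unitInterval, τ = 0 ∨ (τ : ℝ) * t ∈ params k D.δ a := fun τ => by
    rcases τ.2.1.eq_or_lt with h | h
    · exact Or.inl (Subtype.ext h.symm)
    · exact Or.inr (mul_mem_params ht h τ.2.2)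
  have hinj : ∀ τ, Function.Injective fun p => Ψ (τ, p) := by
    intro τ p p' h
    rcases hτ τ with rfl | hm
    · exact Subtype.ext ((hΨ0 p).symm.trans (h.trans (hΨ0 p')))
    · exact Subtype.ext ((D.Ψ_bijOn a _ hm).injOn p.2 p'.2 h)
  have hmem : ∀ q : unitInterval × Torus, ∃ p, Ψ (q.1, p) = Θ q := by
    rintro ⟨τ, g⟩
    rcases hτ τ with rfl | hm
    · exact ⟨S.ι (change a g), (hΨ0 _).trans (hΘ0 g).symm⟩
    · have hg : ‖(g.2 : ℂ)‖ = 1 := Circle.norm_coe _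
      obtain ⟨p, hp, h⟩ := (D.Ψ_bijOn a _ hm).surjOn ⟨D.solidTorus_mem_N hm g.1 hg.le,
        (not_congr (D.solidTorus_mem_ball_iff hm g.1 hg.le)).2 (not_not.2 hg)⟩
      exact ⟨⟨p, hp⟩, h⟩
  obtain ⟨H, hH⟩ := exists_lift_through_isotopy Ψ hinj Θ hmem
  have hc : ∀ τ : unitInterval, Continuous fun g : Torus => H (τ, g) := fun τ => by fun_prop
  refine ⟨⟨fun g => H (1, g), hc 1⟩, ⟨⟨H, fun g => ?_, fun g => rfl⟩⟩, ?_⟩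
  · refine Subtype.ext ?_
    rw [← hΨ0]
    exact (hH (0, g)).trans (hΘ0 g)
  · ext g
    have h := hH (1, g)
    change D.Ψ a ((1 : ℝ) * t) (H (1, g)) = D.Φ a ((1 : ℝ) * t)
      (solidTorus S.ρ a ((1 : ℝ) * t / (k a * Real.pi)) g.1 g.2) at h
    rw [one_mul] at h
    exact h

/-- The order of `H₁(N^a_t; ℤ)` is `|k^a|` times the index of `ι_*(H₁(G; ℤ))` in `H₁(P; ℤ)`. -/
theorem weight_eq [T2Space M] {ζ : H1 ℤ Torus} (hζ : S.IsKernelGenerator ζ) {u : H1 ℤ Circle}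
    (hu : Submodule.span ℤ {u} = ⊤) (hk : IsIndexTriple u ζ k) (ht : t ∈ params k D.δ a) :
    weight (D.N a t) = (k a).natAbs * (H1map ℤ S.ι).toAddMonoidHom.range.index := by
  obtain ⟨hs, hker⟩ := (D.isDehnFilling ht).surjective_and_ker hu
  obtain ⟨β, hβ, hb⟩ := D.exists_homotopic_boundary ht
  have hT := D.H1map_transfer_bijective ht
  have hζ' : ζ = torusHom u (k 0, k 1) := hk.1
  refine natCard_H1_eq hu S.ι hk.2 (by rw [← hζ']; exact hζ) a
    (H1map ℤ (incl (D.outside a t)) ∘ₗ H1map ℤ (D.transfer ht)) (hs.comp hT.2) ?_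
  have hm : H1map ℤ ((D.isDehnFilling ht).boundary.comp (sliceRight Circle 1)) u =
      H1map ℤ (D.transfer ht) (H1map ℤ S.ι (torusHom u (meridianVec a))) := by
    rw [← hb, ContinuousMap.comp_assoc, H1map_comp, H1map_comp, ← H1map_eq_of_homotopic hβ,
      ← H1map_change_meridian, H1map_comp, H1map_comp]
    rfl
  rw [LinearMap.ker_comp, hker, hm]
  ext x
  rw [Submodule.mem_comap, mem_span_singleton_iff_zsmul, mem_span_singleton_iff_zsmul]
  refine exists_congr fun n => ?_
  rw [← map_zsmul, hT.1.eq_iff]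

end Desingularization

end Geometry

end SLCount

end

theorem proposition7p1 {M : Type} [TopologicalSpace M] [T2Space M] [CompactSpace M]
    [ConnectedSpace M] [ChartedSpace SLCount.C3 M] [IsManifold 𝓘(ℝ, SLCount.C3) ∞ M]
    (ε : ℝ) (hε : 0 < ε) (A : ℝ → SLCount.AlmostCY M) (hA : SLCount.IsSmoothFamily A ε)
    (S : SLCount.ConeSingularity (A 0))
    (ζ : SLCount.H1 ℤ SLCount.Torus) (hζ : S.IsKernelGenerator ζ)
    (u : SLCount.H1 ℤ Circle) (hu : Submodule.span ℤ {u} = ⊤)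
    (k : Fin 3 → ℤ) (hk : SLCount.IsIndexTriple u ζ k)
    (D : SLCount.Desingularization A ε S k)
    (t t' : ℝ) (ht : t ∈ Ioo 0 D.δ) (ht' : t' ∈ Ioo (-D.δ) 0) :
    (∑ a : Fin 3 with 0 < k a, SLCount.weight (D.N a t)) =
      ∑ a : Fin 3 with k a < 0, SLCount.weight (D.N a t') := by
  refine SLCount.sum_pos_eq_sum_neg hk.2 _
    (fun a ha => D.weight_eq hζ hu hk ⟨?_, ?_⟩) (fun a ha => D.weight_eq hζ hu hk ⟨?_, ?_⟩)
  · rw [abs_of_pos ht.1]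
    exact ht.2
  · exact mul_pos (Int.cast_pos.2 ha) ht.1
  · rw [abs_of_neg ht'.2]
    exact neg_lt.1 ht'.1
  · exact mul_pos_of_neg_of_neg (Int.cast_lt_zero.2 ha) ht'.2
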